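/- All formulae are propositional, over the variables $x_0,x_1,\dots$. A default is $d=\frac{\alpha:\beta}{\gamma}$ with $prec(d)=\alpha$, $just(d)=\beta$, $cons(d)=\gamma$; it is normal if $\beta=\gamma$. A default theory is a pair $\langle D,W\rangle$ of a finite set $D$ of defaults and a finite consistent set $W$ of formulae; it is normal if all its defaults are, and its size is the length of its formulae, variable indices being written in binary. A process of $\langle D,W\rangle$ is a sequence $\Pi$ of distinct defaults of $D$ such that $W\cup cons(\Pi)$ is consistent and, for every $d\in\Pi$, the formula $prec(d)$ follows from $W$ together with the consequences of the defaults preceding $d$ in $\Pi$. A semantics consists of two conditions on $\Pi$ and $\langle D,W\rangle$, successfulness and closure; the extensions of $\langle D,W\rangle$ are the deductive closures of $W\cup cons(\Pi)$, for the successful and closed processes $\Pi$. The semantics is regular if: (1) when a process $\Pi\cdot\Pi'$ is successful, so is $\Pi$; (2) the empty sequence is successful; (3) successfulness and closure of a process $\Pi$ of $T=\langle D,W\rangle$ are each equivalent to $L(o_1,\dots,o_u)=1$, where $L$ is a Boolean function on bit strings, computable in polynomial time and fixed for the condition, and $o_i$ tells whether a formula $\omega_i$ is satisfiable after each proposition $(d\in\Pi)$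 has been replaced by its truth value; here $\omega_1,\dots,\omega_u$ is a list of formulae, depending on $T$ only, over the variables of $T$ and the propositions $(d\in\Pi)$ for $d\in D$, and both $u$ and the sizes of the $\omega_i$ are bounded by a fixed polynomial in the size of $T$. In Reiter's semantics $\Pi$ is successful if $W\cup cons(\Pi)\cup\{just(d)\}$ is consistent for every $d\in\Pi$, and closed if for every $d\in D\setminus\Pi$ either $W\cup cons(\Pi)\not\models prec(d)$ or $W\cup cons(\Pi)\cup\{just(d)\}$ is inconsistent. Two sets of formulae are var-equivalent w.r.t. a set of variables $X$ if they entail the same formulae among those that contain only variables in $X$. **Theorem.** For every regular semantics $S$ there are a translation $T\mapsto T'$ of default theories and a polynomial $p$ such that, for every default theory $T$ that has at least one extension under $S$, the theory $T'$ is a normal default theory of size at most $p(\mathrm{size}(T))$, and there is a bijection between the extensions of $T$ under $S$ and the extensions of $T'$ under Reiter's semantics, the latter taken modulo var-equivalence w.r.t. the variables $X$ occurring in $T$, under which an extension of $T$ corresponds exactly to the extensions of $T'$ that are var-equivalent to it w.r.t. $X$. -/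

import Mathlib

namespace DefaultLogic

/-! ### Propositional logic -/

/-- Propositional formulae over the atoms `α`. -/
inductive Form (α : Type) : Type where
  | atom (a : α) : Form α
  | fls : Form α
  | neg (φ : Form α) : Form α
  | conj (φ ψ : Form α) : Form α
  | disj (φ ψ : Form α) : Form α
  | imp (φ ψ : Form α) : Form α

/-- Truth of a formula under a valuation of the atoms. -/
def Form.Holds {α : Type} (v : α → Prop) : Form α → Prop
  | .atom a => v a
  | .fls => False
  | .neg φ => ¬ φ.Holds v
  | .conj φ ψ => φ.Holds v ∧ ψ.Holds v
  | .disj φ ψ => φ.Holds v ∨ ψ.Holds v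
  | .imp φ ψ => φ.Holds v → ψ.Holds v

/-- The atoms occurring in a formula. -/
def Form.atoms {α : Type} : Form α → Set α
  | .atom a => {a}
  | .fls => ∅
  | .neg φ => φ.atoms
  | .conj φ ψ => φ.atoms ∪ ψ.atoms
  | .disj φ ψ => φ.atoms ∪ ψ.atoms
  | .imp φ ψ => φ.atoms ∪ ψ.atoms

/-- Size of a formula, where `w a` is the cost of writing the atom `a` and every
other symbol costs one. -/
def Form.sizeWith {α : Type} (w : α → ℕ) : Form α → ℕ
  | .atom a => w a
  | .fls => 1
  | .neg φ => φ.sizeWith w + 1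
  | .conj φ ψ => φ.sizeWith w + ψ.sizeWith w + 1
  | .disj φ ψ => φ.sizeWith w + ψ.sizeWith w + 1
  | .imp φ ψ => φ.sizeWith w + ψ.sizeWith w + 1

/-- The formulae of default theories: the propositional variables are the natural numbers. -/
abbrev PForm : Type := Form ℕ

/-- The cost of writing the variable with index `n`: one symbol and the binary digits of `n`. -/
def varCost (n : ℕ) : ℕ := 1 + Nat.size n

/-- The size of a formula, as a written text. -/
def Form.size (φ : PForm) : ℕ := φ.sizeWith varCost

/-- A set of formulae is consistent if it has a model. -/
def Consistent (Γ : Set PForm) : Prop := ∃ v : ℕ → Prop, ∀ φ ∈ Γ, φ.Holds v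

/-- Logical consequence. -/
def Entails (Γ : Set PForm) (φ : PForm) : Prop :=
  ∀ v : ℕ → Prop, (∀ ψ ∈ Γ, ψ.Holds v) → φ.Holds v

/-- Deductive closure. -/
def Cn (Γ : Set PForm) : Set PForm := {φ | Entails Γ φ}

/-- Var-equivalence with respect to the variables `X`: the same consequences among the formulae
that only contain variables in `X`. -/
def VarEquiv (X : Set ℕ) (Γ Δ : Set PForm) : Prop :=
  ∀ φ : PForm, φ.atoms ⊆ X → (Entails Γ φ ↔ Entails Δ φ)

/-! ### Default theories and processes -/

/-- A default `prec : just / cons`. -/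
structure Default : Type where
  prec : PForm
  just : PForm
  cons : PForm

/-- A default is normal if its justification is its consequence. -/
def Default.IsNormal (d : Default) : Prop := d.just = d.cons

def Default.vars (d : Default) : Set ℕ := d.prec.atoms ∪ d.just.atoms ∪ d.cons.atoms

def Default.size (d : Default) : ℕ := d.prec.size + d.just.size + d.cons.size

/-- A default theory `⟨D, W⟩`: finitely many defaults and a consistent finite background theory. -/
structure DefaultTheory : Type where
  D : Finset Default
  W : Finset PForm
  consistent : Consistent (W : Set PForm)

namespace DefaultTheory

/-- The variables occurring in the theory. -/
def vars (T : DefaultTheory) : Set ℕ :=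
  {n | (∃ φ ∈ T.W, n ∈ φ.atoms) ∨ ∃ d ∈ T.D, n ∈ d.vars}

def size (T : DefaultTheory) : ℕ := ∑ φ ∈ T.W, φ.size + ∑ d ∈ T.D, d.size

/-- All defaults are normal. -/
def IsNormal (T : DefaultTheory) : Prop := ∀ d ∈ T.D, d.IsNormal

/-- `W ∪ cons(Π)`. -/
def base (T : DefaultTheory) (P : List Default) : Set PForm :=
  {φ | φ ∈ T.W} ∪ {φ | ∃ d ∈ P, d.cons = φ}

/-- A process: a sequence of distinct defaults of `D` such that `W ∪ cons(Π)` is consistent and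
the precondition of each `d` in `Π` follows from `W` and the consequences of the defaults
that precede `d`. -/
structure IsProc (T : DefaultTheory) (P : List Default) : Prop where
  mem : ∀ d ∈ P, d ∈ T.D
  nodup : P.Nodup
  consistent : Consistent (T.base P)
  prec : ∀ (P₁ P₂ : List Default) (d : Default), P = P₁ ++ d :: P₂ → Entails (T.base P₁) d.prec

end DefaultTheory

/-! ### Semantics -/

/-- A condition on sequences of defaults of a default theory. -/
abbrev Condition : Type := DefaultTheory → List Default → Prop

/-- A semantics of default logic, given by its conditions of successfulness and closure. -/
structure Semantics : Type where
  Successful : Condition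
  Closed : Condition

/-- An extension is the deductive closure of `W ∪ cons(Π)` for a successful and closed
process `Π`. -/
def Semantics.extensions (S : Semantics) (T : DefaultTheory) : Set (Set PForm) :=
  {E | ∃ P : List Default, T.IsProc P ∧ S.Successful T P ∧ S.Closed T P ∧ E = Cn (T.base P)}

/-- Reiter's semantics: local successfulness, and closure as inapplicability. -/
def reiter : Semantics where
  Successful T P := ∀ d ∈ P, Consistent (T.base P ∪ {d.just})
  Closed T P := ∀ d ∈ T.D, d ∉ P → ¬ Entails (T.base P) d.prec ∨ ¬ Consistent (T.base P ∪ {d.just})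

/-! ### Regular semantics -/

/-- The formulae to be checked for consistency: besides propositional variables (`Sum.inl n`) they
may contain the propositions `d ∈ Π` (`Sum.inr d`). -/
abbrev TestForm : Type := Form (ℕ ⊕ Default)

/-- The size of a test formula; a proposition `d ∈ Π` counts as one symbol. -/
def testSize (ω : TestForm) : ℕ := ω.sizeWith (Sum.elim varCost fun _ => 1)

/-- The test formula `ω` is over the variables and the defaults of `T`. -/
def TestOver (T : DefaultTheory) (ω : TestForm) : Prop :=
  (∀ n : ℕ, Sum.inl n ∈ ω.atoms → n ∈ T.vars) ∧ (∀ d : Default, Sum.inr d ∈ ω.atoms → d ∈ T.D)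

/-- The consistency test of `ω` on `Π`: is `ω` satisfiable when each `d ∈ Π` has its actual
truth value? The order of the defaults in `Π` plays no role. -/
def TestPasses (P : List Default) (ω : TestForm) : Prop :=
  ∃ v : ℕ → Prop, ω.Holds (Sum.elim v fun d => d ∈ P)

open Classical in
/-- The results of a list of consistency tests, as a string of bits. -/
noncomputable def testResults (P : List Default) (tests : List TestForm) : List Bool :=
  tests.map fun ω => decide (TestPasses P ω)

/-- A Boolean function of bit strings computed by a Turing machine in time polynomial in the length
of its input. -/
def PolyTimeDecidable (L : List Bool → Bool) : Prop :=
  Nonempty (Turing.TM2ComputableInPolyTime (id : List Bool → List Bool) Computability.encodeBool L)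

/-- On processes, the condition is a polynomial-time combination of the results of polynomially
many consistency tests of polynomial size over the theory. Inputs of the combination besides the
results proper (membership of a default in `Π`, constant bits) are available as results of
tests such as `d ∈ Π`, `⊥` and `¬ ⊥`. -/
def TestDefinable (C : Condition) : Prop :=
  ∃ (tests : DefaultTheory → List TestForm) (q : Polynomial ℕ) (L : List Bool → Bool),
    (∀ T : DefaultTheory, (tests T).length ≤ q.eval T.size) ∧
    (∀ T : DefaultTheory, ∀ ω ∈ tests T, TestOver T ω ∧ testSize ω ≤ q.eval T.size) ∧
    PolyTimeDecidable L ∧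
    ∀ (T : DefaultTheory) (P : List Default), T.IsProc P →
      (C T P ↔ L (testResults P (tests T)) = true)

/-- Regular semantics. -/
structure Semantics.IsRegular (S : Semantics) : Prop where
  antimonotonic : ∀ (T : DefaultTheory) (P P' : List Default),
    T.IsProc (P ++ P') → S.Successful T (P ++ P') → S.Successful T P
  successful_nil : ∀ T : DefaultTheory, S.Successful T []
  successful_tests : TestDefinable S.Successful
  closed_tests : TestDefinable S.Closed

/-! ### Faithful translations into normal default logic -/

/-- Var-equivalence with respect to `X` on a collection of sets of formulae. -/
def varSetoid (X : Set ℕ) (A : Set (Set PForm)) : Setoid A where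
  r E E' := VarEquiv X E E'
  iseqv :=
    { refl := fun _ _ _ => Iff.rfl
      symm := fun h φ hφ => (h φ hφ).symm
      trans := fun h h' φ hφ => (h φ hφ).trans (h' φ hφ) }

/-- The extensions of `T` under `S` correspond bijectively to the extensions of `T'` under `S'`
modulo var-equivalence with respect to the variables of `T`, corresponding extensions being
var-equivalent. -/
def Faithful (S S' : Semantics) (T T' : DefaultTheory) : Prop :=
  ∃ f : S.extensions T → Quotient (varSetoid T.vars (S'.extensions T')),
    Function.Bijective f ∧
    ∀ (E : S.extensions T) (E' : S'.extensions T'),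
      f E = Quotient.mk _ E' ↔ VarEquiv T.vars (E : Set PForm) (E' : Set PForm)

end DefaultLogic

/-! The normal theory guesses a process, lets defaults determine the results of all consistency
tests, and computes from these results whether the guess is an extension of `T`. Its background
theory is a single formula `Ω`, and all its defaults have the precondition `verum`. Defaults for
both signs of an atom guess which defaults of `T` belong to the process and which precede which; a
positive default for each test `i` sets a signal `sig i`.

The formula `Ω` contains only the implication from `sig i` to the test, written over a private copy
of the variables. Setting a signal is therefore consistent exactly when the test is satisfiable for
the guess, and since the copies are disjoint, no signal obstructs another. So each guess has one
greatest set of consistent signals, and Reiter closure forces all of it: a signal left unset means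
that its test is unsatisfiable. In this way normal defaults evaluate both satisfiability and
unsatisfiability (`extensions_guessTheory`, `TrData.Valid.isMaxModel_iff`).

Being a process is itself expressed by two tests. `goodTest` must be satisfiable: the consequences
are consistent and the precedence is a strict partial order. `badTest` must be unsatisfiable: no
precondition fails to follow from the preceding consequences. The polynomial-time combination of the
remaining results is described by a formula with auxiliary atoms, obtained from the computation
tableau of the machine (`PolyTimeDecidable.exists_form`). Its output is determined by the signals,
and so is the atom `ok`, which states that the guess is accepted.

If `ok` holds, `Ω` releases the guessed consequences on the original variables; otherwise it
releases those of a fixed successful and closed process of `T`. A rejected guess thus yields an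
extension that is needed anyway, and this is where `T` must have an extension. Conversely every
process of `T` describes an accepted guess, so extensions match up to var-equivalence in both
directions (`TrData.Valid.faithful`), which suffices by `faithful_of_varEquiv`. There remain the
coding of the atoms by numbers with short binary expansions and a count of symbols. -/

namespace DefaultLogic

/-! ### Semantics, atoms and lengths of propositional formulae -/

namespace Form

variable {α β : Type}

/-- The true formula. -/
def verum : Form α := .neg .fls

/-- Equivalence of two formulae. -/
def iff (φ ψ : Form α) : Form α := .conj (.imp φ ψ) (.imp ψ φ)

/-- Conjunction of a list of formulae. -/
def conjList : List (Form α) → Form α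
  | [] => verum
  | φ :: l => .conj φ (conjList l)

/-- Disjunction of a list of formulae. -/
def disjList : List (Form α) → Form α
  | [] => .fls
  | φ :: l => .disj φ (disjList l)

/-- Renaming of atoms. -/
def map (f : α → β) : Form α → Form β
  | .atom a => .atom (f a)
  | .fls => .fls
  | .neg φ => .neg (φ.map f)
  | .conj φ ψ => .conj (φ.map f) (ψ.map f)
  | .disj φ ψ => .disj (φ.map f) (ψ.map f)
  | .imp φ ψ => .imp (φ.map f) (ψ.map f)

/-- Number of symbols of a formula. -/
def len (φ : Form α) : ℕ := φ.sizeWith fun _ => 1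

/-- Decision tree over the atoms in a list for a property of valuations. -/
def table [DecidableEq α] : List α → ((α → Bool) → Bool) → Form α
  | [], g => bif g fun _ => false then verum else .fls
  | a :: l, g =>
    .disj (.conj (.atom a) (table l fun v => g (Function.update v a true)))
      (.conj (.neg (.atom a)) (table l fun v => g (Function.update v a false)))

@[simp] theorem holds_atom (v : α → Prop) (a : α) : (Form.atom a).Holds v ↔ v a := Iff.rfl
@[simp] theorem holds_fls (v : α → Prop) : (Form.fls : Form α).Holds v ↔ False := Iff.rfl
@[simp] theorem holds_neg (v : α → Prop) (φ : Form α) : φ.neg.Holds v ↔ ¬ φ.Holds v := Iff.rfl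
@[simp] theorem holds_conj (v : α → Prop) (φ ψ : Form α) :
    (φ.conj ψ).Holds v ↔ φ.Holds v ∧ ψ.Holds v := Iff.rfl
@[simp] theorem holds_disj (v : α → Prop) (φ ψ : Form α) :
    (φ.disj ψ).Holds v ↔ φ.Holds v ∨ ψ.Holds v := Iff.rfl
@[simp] theorem holds_imp (v : α → Prop) (φ ψ : Form α) :
    (φ.imp ψ).Holds v ↔ (φ.Holds v → ψ.Holds v) := Iff.rfl
@[simp] theorem holds_verum (v : α → Prop) : (verum : Form α).Holds v := fun h => h
@[simp] theorem holds_iff (v : α → Prop) (φ ψ : Form α) :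
    (φ.iff ψ).Holds v ↔ (φ.Holds v ↔ ψ.Holds v) :=
  ⟨fun h => ⟨h.1, h.2⟩, fun h => ⟨h.1, h.2⟩⟩

@[simp] theorem holds_conjList (v : α → Prop) (l : List (Form α)) :
    (conjList l).Holds v ↔ ∀ φ ∈ l, φ.Holds v := by
  induction l with
  | nil => simp [conjList]
  | cons φ l ih => simp [conjList, ih]

@[simp] theorem holds_disjList (v : α → Prop) (l : List (Form α)) :
    (disjList l).Holds v ↔ ∃ φ ∈ l, φ.Holds v := by
  induction l with
  | nil => simp [disjList]
  | cons φ l ih => simp [disjList, ih]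

theorem holds_map (f : α → β) (v : β → Prop) (φ : Form α) :
    (φ.map f).Holds v ↔ φ.Holds fun a => v (f a) := by
  induction φ <;> simp_all [map]

theorem holds_congr {v w : α → Prop} {φ : Form α} (h : ∀ a ∈ φ.atoms, (v a ↔ w a)) :
    φ.Holds v ↔ φ.Holds w := by
  induction φ with
  | atom a => exact h a rfl
  | fls => exact Iff.rfl
  | neg φ ih => exact not_congr (ih h)
  | conj φ ψ ih ih' =>
    exact and_congr (ih fun a ha => h a (Or.inl ha)) (ih' fun a ha => h a (Or.inr ha))
  | disj φ ψ ih ih' =>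
    exact or_congr (ih fun a ha => h a (Or.inl ha)) (ih' fun a ha => h a (Or.inr ha))
  | imp φ ψ ih ih' =>
    exact imp_congr (ih fun a ha => h a (Or.inl ha)) (ih' fun a ha => h a (Or.inr ha))

theorem atoms_map (f : α → β) (φ : Form α) : (φ.map f).atoms = f '' φ.atoms := by
  induction φ <;> simp_all [map, atoms, Set.image_union]

theorem atoms_finite (φ : Form α) : φ.atoms.Finite := by
  induction φ <;> simp_all [atoms]

theorem ncard_atoms_le (φ : Form α) : φ.atoms.ncard ≤ φ.len := by
  induction φ with
  | atom a => simp [atoms, len, sizeWith]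
  | fls => simp [atoms]
  | neg φ ih => exact ih.trans (Nat.le_succ _)
  | conj φ ψ ih ih' | disj φ ψ ih ih' | imp φ ψ ih ih' =>
    exact (Set.ncard_union_le _ _).trans ((Nat.add_le_add ih ih').trans (Nat.le_succ _))

theorem sizeWith_le_len_mul {w : α → ℕ} {B : ℕ} (hB : 1 ≤ B) {φ : Form α}
    (h : ∀ a ∈ φ.atoms, w a ≤ B) : φ.sizeWith w ≤ φ.len * B := by
  induction φ with
  | atom a => simpa [len, sizeWith] using h a rfl
  | fls => simpa [len, sizeWith] using hB
  | neg φ ih =>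
    have := ih h
    simp only [len, sizeWith, add_mul] at *
    omega
  | conj φ ψ ih ih' | disj φ ψ ih ih' | imp φ ψ ih ih' =>
    have h1 := ih fun a ha => h a (Or.inl ha)
    have h2 := ih' fun a ha => h a (Or.inr ha)
    simp only [len, sizeWith, add_mul] at *
    omega

theorem len_le_sizeWith {w : α → ℕ} (h : ∀ a, 1 ≤ w a) (φ : Form α) :
    φ.len ≤ φ.sizeWith w := by
  induction φ with
  | atom a => exact h a
  | _ => simp only [len, sizeWith] at *; omega

theorem le_sizeWith_of_mem_atoms {w : α → ℕ} {φ : Form α} {a : α} (ha : a ∈ φ.atoms) :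
    w a ≤ φ.sizeWith w := by
  induction φ with
  | atom b => cases ha; exact le_rfl
  | fls => cases ha
  | neg φ ih => exact (ih ha).trans (Nat.le_succ _)
  | conj φ ψ ih ih' | disj φ ψ ih ih' | imp φ ψ ih ih' =>
    simp only [sizeWith]
    rcases ha with ha | ha
    · have := ih ha
      omega
    · have := ih' ha
      omega

@[simp] theorem len_atom (a : α) : (Form.atom a).len = 1 := rfl
@[simp] theorem len_fls : (Form.fls : Form α).len = 1 := rfl
@[simp] theorem len_neg (φ : Form α) : φ.neg.len = φ.len + 1 := rfl
@[simp] theorem len_conj (φ ψ : Form α) : (φ.conj ψ).len = φ.len + ψ.len + 1 := rfl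
@[simp] theorem len_disj (φ ψ : Form α) : (φ.disj ψ).len = φ.len + ψ.len + 1 := rfl
@[simp] theorem len_imp (φ ψ : Form α) : (φ.imp ψ).len = φ.len + ψ.len + 1 := rfl
@[simp] theorem len_verum : (verum : Form α).len = 2 := rfl
@[simp] theorem len_iff (φ ψ : Form α) : (φ.iff ψ).len = 2 * φ.len + 2 * ψ.len + 3 := by
  simp only [iff, len_conj, len_imp]
  omega

theorem len_pos (φ : Form α) : 1 ≤ φ.len := by
  cases φ <;> simp

@[simp] theorem len_map (f : α → β) (φ : Form α) : (φ.map f).len = φ.len := by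
  induction φ <;> simp_all [map]

theorem len_conjList_le {l : List (Form α)} {m : ℕ} (h : ∀ φ ∈ l, φ.len ≤ m) :
    (conjList l).len ≤ l.length * (m + 1) + 2 := by
  induction l with
  | nil => simp [conjList]
  | cons φ l ih =>
    have h1 := h φ (by simp)
    have h2 := ih fun ψ hψ => h ψ (by simp [hψ])
    simp only [conjList, len_conj, List.length_cons, add_mul, one_mul]
    omega

theorem len_disjList_le {l : List (Form α)} {m : ℕ} (h : ∀ φ ∈ l, φ.len ≤ m) :
    (disjList l).len ≤ l.length * (m + 1) + 2 := by
  induction l with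
  | nil => simp [disjList]
  | cons φ l ih =>
    have h1 := h φ (by simp)
    have h2 := ih fun ψ hψ => h ψ (by simp [hψ])
    simp only [disjList, len_disj, List.length_cons, add_mul, one_mul]
    omega

theorem atoms_conjList (l : List (Form α)) : (conjList l).atoms = {a | ∃ φ ∈ l, a ∈ φ.atoms} := by
  induction l with
  | nil => simp [conjList, verum, atoms]
  | cons φ l ih => ext a; simp [conjList, atoms, ih]

theorem len_table_le [DecidableEq α] (l : List α) (g : (α → Bool) → Bool) :
    (table l g).len ≤ 9 * 2 ^ l.length := by
  -- A branching adds six symbols to its two subtrees, so length plus 6 is additive and at most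
  -- doubles with each atom.
  suffices h : (table l g).len + 6 ≤ 9 * 2 ^ l.length by omega
  induction l generalizing g with
  | nil => cases h : g fun _ => false <;> simp [table, h]
  | cons a l ih =>
    have h1 := ih fun v => g (Function.update v a true)
    have h2 := ih fun v => g (Function.update v a false)
    simp only [table, len_disj, len_conj, len_atom, len_neg, List.length_cons, pow_succ]
    omega

-- The leaves evaluate `g` with every unlisted atom set to false. This is harmless only because `g`
-- is assumed to depend on nothing but the listed atoms.
open Classical in
theorem holds_table (l : List α) (g : (α → Bool) → Bool)
    (hg : ∀ v w : α → Bool, (∀ a ∈ l, v a = w a) → g v = g w) (v : α → Prop) :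
    (table l g).Holds v ↔ g (fun a => decide (v a)) = true := by
  induction l generalizing g with
  | nil =>
    rw [hg (fun a => decide (v a)) (fun _ => false) (by simp)]
    cases h : g fun _ => false <;> simp [table, h]
  | cons a l ih =>
    have key : ∀ b : Bool, (table l fun w => g (Function.update w a b)).Holds v ↔
        g (Function.update (fun c => decide (v c)) a b) = true := by
      intro b
      refine ih _ fun w w' h => hg _ _ fun c hc => ?_
      by_cases hca : c = a
      · simp [hca]
      · simpa [hca] using h c (by simpa [hca] using hc)
    have upd : Function.update (fun c => decide (v c)) a (decide (v a)) =
        fun c => decide (v c) := Function.update_eq_self a _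
    simp only [table, holds_disj, holds_conj, holds_atom, holds_neg, key]
    by_cases hv : v a
    · rw [decide_eq_true hv] at upd
      simp [hv, upd]
    · rw [decide_eq_false hv] at upd
      simp [hv, upd]

end Form

/-! ### Polynomial-time functions have formulae of polynomial size -/

section LocalDynamics

variable {C A : Type}

open Classical in
/-- A property of configurations that is determined by finitely many observables is expressed
by a formula over these observables. -/
theorem exists_form_of_determined (obs : C → A → Prop) (Inv : C → Prop) (l : List A) (f : C → Prop)
    (h : ∀ c c', Inv c → Inv c' → (∀ a ∈ l, (obs c a ↔ obs c' a)) → (f c ↔ f c')) :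
    ∃ φ : Form A, φ.len ≤ 9 * 2 ^ l.length ∧
      ∀ c, Inv c → ∀ v : A → Prop, (∀ a ∈ l, (v a ↔ obs c a)) → (φ.Holds v ↔ f c) := by
  -- The table asks whether some invariant configuration with these observables has the property; by
  -- `h` all such configurations agree, so existence decides the property.
  refine ⟨Form.table l fun v => decide (∃ c, Inv c ∧ (∀ a ∈ l, (v a = true ↔ obs c a)) ∧ f c),
    Form.len_table_le _ _, fun c hc v hv => ?_⟩
  rw [Form.holds_table]
  · simp only [decide_eq_true_eq]
    constructor
    · rintro ⟨c', hc', h', hf⟩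
      exact (h c' c hc' hc fun a ha => (h' a ha).symm.trans (hv a ha)).1 hf
    · exact fun hf => ⟨c, hc, hv, hf⟩
  · intro v w hvw
    have : ∀ c, (∀ a ∈ l, (v a = true ↔ obs c a)) ↔ (∀ a ∈ l, (w a = true ↔ obs c a)) :=
      fun c => forall₂_congr fun a ha => by rw [hvw a ha]
    simp only [this]

variable {κ : Type} [Fintype κ]

/-- The iterates of a step function that changes the observables at a position depending only on
the observables nearby and on those at the first few positions are described by formulae of
size quadratic in the number of steps. -/
theorem exists_form_iterate (obs : C → ℕ × κ → Prop) (step : C → C) (Inv : C → Prop)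
    (inv_step : ∀ c, Inv c → Inv (step c)) (n : ℕ)
    (step_local : ∀ c c', Inv c → Inv c' → ∀ i,
      (∀ j, j < n ∨ (i ≤ j + n ∧ j ≤ i + n) → ∀ k, (obs c (j, k) ↔ obs c' (j, k))) →
      ∀ k, (obs (step c) (i, k) ↔ obs (step c') (i, k)))
    (init : (ℕ → Prop) → C) (inv_init : ∀ x, Inv (init x))
    (init_local : ∀ x y i, (x i ↔ y i) → ∀ k, (obs (init x) (i, k) ↔ obs (init y) (i, k)))
    (T : ℕ) (k₀ : κ) :
    ∃ φ : Form (ℕ ⊕ ℕ × ℕ × κ),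
      φ.len ≤ (T + 1) * ((n * T + 1) * Fintype.card κ) *
        (18 * 2 ^ ((3 * n + 1) * Fintype.card κ + 1) + 6) + 2 ∧
      ∀ x : ℕ → Prop, (∃ g, φ.Holds (Sum.elim x g)) ∧
        ∀ g, φ.Holds (Sum.elim x g) → (g (T, 0, k₀) ↔ obs (step^[T] (init x)) (0, k₀)) := by
  -- A window consists of the first `n` positions and the `2 * n + 1` positions around `i`.
  set m := (3 * n + 1) * Fintype.card κ with hm
  have hinit : ∀ (i : ℕ) (k : κ), ∃ ψ : Form ℕ, ψ.len ≤ 9 * 2 ^ (m + 1) ∧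
      ∀ x : ℕ → Prop, (ψ.Holds x ↔ obs (init x) (i, k)) := by
    intro i k
    obtain ⟨ψ, hψ, h⟩ := exists_form_of_determined (fun (x : ℕ → Prop) j => x j) (fun _ => True)
      [i] (fun x => obs (init x) (i, k))
      (fun x y _ _ hxy => init_local x y i (hxy i (by simp)) k)
    refine ⟨ψ, hψ.trans ?_, fun x => h x trivial x fun _ _ => Iff.rfl⟩
    gcongr
    · norm_num
    · simp
  have hstep : ∀ (i : ℕ) (k : κ), ∃ ψ : Form (ℕ × κ), ψ.len ≤ 9 * 2 ^ (m + 1) ∧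
      ∀ c, Inv c → ∀ v : ℕ × κ → Prop, (∀ j ≤ i + n, ∀ k', (v (j, k') ↔ obs c (j, k'))) →
        (ψ.Holds v ↔ obs (step c) (i, k)) := by
    intro i k
    let l : List (ℕ × κ) := (List.range n ++ List.range' (i - n) (i + n + 1 - (i - n))) ×ˢ
      (Finset.univ : Finset κ).toList
    have hl : ∀ j k', (j, k') ∈ l ↔ j < n ∨ (i - n ≤ j ∧ j < i - n + (i + n + 1 - (i - n))) := by
      intro j k'
      simp [l, List.mem_range'_1]
    have hlen : l.length ≤ m := by
      simp only [l, List.length_product, List.length_append, List.length_range, List.length_range',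
        Finset.length_toList, Finset.card_univ, hm]
      exact Nat.mul_le_mul_right _ (by omega)
    obtain ⟨ψ, hψ, h⟩ := exists_form_of_determined obs Inv l (fun c => obs (step c) (i, k))
      (fun c c' hc hc' hcc => step_local c c' hc hc' i
        (fun j hj k' => hcc (j, k') ((hl j k').2 (by omega))) k)
    refine ⟨ψ, hψ.trans ?_, fun c hc v hv => h c hc v ?_⟩
    · gcongr
      · norm_num
      · omega
    · rintro ⟨j, k'⟩ ha
      have := (hl j k').1 ha
      exact hv j (by omega) k'
  choose ψ₀ hψ₀ hψ₀' using hinit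
  choose ψ hψ hψ' using hstep
  -- The atom `(t, i, k)` stands for the observable `k` at position `i` after `t` steps; its gate
  -- expresses it by observables at time `t - 1`, or by the input when `t = 0`.
  let gate : ℕ × ℕ × κ → Form (ℕ ⊕ ℕ × ℕ × κ) := fun a => Nat.casesOn a.1
    (.iff (.atom (.inr (0, a.2))) ((ψ₀ a.2.1 a.2.2).map Sum.inl))
    (fun t => .iff (.atom (.inr (t + 1, a.2))) ((ψ a.2.1 a.2.2).map fun b => .inr (t, b)))
  have inv_iter : ∀ x t, Inv (step^[t] (init x)) := by
    intro x t
    induction t with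
    | zero => exact inv_init x
    | succ t ih => rw [Function.iterate_succ_apply']; exact inv_step _ ih
  refine ⟨Form.conjList ((List.range (T + 1) ×ˢ (List.range (n * T + 1) ×ˢ
    (Finset.univ : Finset κ).toList)).map gate), ?_,
    fun x => ⟨⟨fun a => obs (step^[a.1] (init x)) a.2, ?_⟩, ?_⟩⟩
  · refine (Form.len_conjList_le (m := 18 * 2 ^ (m + 1) + 5) ?_).trans ?_
    · simp only [List.mem_map]
      rintro _ ⟨⟨t, i, k⟩, -, rfl⟩
      cases t with
      | zero =>
        have := hψ₀ i k
        change (Form.iff _ _).len ≤ _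
        simp only [Form.len_iff, Form.len_atom, Form.len_map]
        omega
      | succ t =>
        have := hψ i k
        change (Form.iff _ _).len ≤ _
        simp only [Form.len_iff, Form.len_atom, Form.len_map]
        omega
    · simp [List.length_product]
  · simp only [Form.holds_conjList, List.mem_map]
    rintro _ ⟨⟨t, i, k⟩, -, rfl⟩
    cases t with
    | zero => simp [gate, Form.holds_map, hψ₀']
    | succ t =>
      simp only [gate, Form.holds_iff, Form.holds_atom, Form.holds_map, Sum.elim_inr]
      rw [hψ' i k _ (inv_iter x t) _ fun _ _ _ => Iff.rfl, Function.iterate_succ_apply']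
  · intro g hg
    simp only [Form.holds_conjList, List.mem_map] at hg
    -- Gates near position `n * T` refer to unconstrained atoms beyond it. Values are forced only in
    -- the region `i ≤ n * (T - t)`, which shrinks by `n` per step and still contains position 0 at
    -- time `T`.
    have key : ∀ t ≤ T, ∀ i ≤ n * (T - t), ∀ k, (g (t, i, k) ↔ obs (step^[t] (init x)) (i, k)) := by
      intro t
      induction t with
      | zero =>
        intro _ i hi k
        have := hg (gate (0, i, k)) ⟨(0, i, k), by simpa [Nat.lt_succ_iff] using hi, rfl⟩
        simpa [gate, Form.holds_map, hψ₀'] using this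
      | succ t ih =>
        intro ht i hi k
        have hT : n * (T - t) = n * (T - (t + 1)) + n := by
          rw [show T - t = T - (t + 1) + 1 by omega, Nat.mul_succ]
        have hT' : n * (T - (t + 1)) ≤ n * T := by gcongr; omega
        have := hg (gate (t + 1, i, k)) ⟨(t + 1, i, k), by simp; omega, rfl⟩
        simp only [gate, Form.holds_iff, Form.holds_atom, Form.holds_map, Sum.elim_inr] at this
        rw [this, hψ' i k _ (inv_iter x t) _ fun j hj k' => ih (by omega) j (by omega) k',
          Function.iterate_succ_apply']
    exact key T le_rfl 0 (Nat.zero_le _) k₀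

end LocalDynamics

/-! ### Locality of the steps of a stack machine -/

section StackMachine

open Turing TM2

variable {K : Type} {Γ : K → Type} {Λ σ : Type}

/-- The number of stack operations in a statement. -/
def stackOps : Stmt Γ Λ σ → ℕ
  | .push _ _ q => stackOps q + 1
  | .peek _ _ q => stackOps q + 1
  | .pop _ _ q => stackOps q + 1
  | .load _ q => stackOps q
  | .branch _ q₁ q₂ => stackOps q₁ + stackOps q₂
  | .goto _ => 0
  | .halt => 0

/-- The symbols that a statement may push. -/
def pushedSymbols : Stmt Γ Λ σ → Set (Σ k, Γ k)
  | .push k f q => Set.range (fun v => ⟨k, f v⟩) ∪ pushedSymbols q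
  | .peek _ _ q => pushedSymbols q
  | .pop _ _ q => pushedSymbols q
  | .load _ q => pushedSymbols q
  | .branch _ q₁ q₂ => pushedSymbols q₁ ∪ pushedSymbols q₂
  | .goto _ => ∅
  | .halt => ∅

theorem finite_pushedSymbols [Finite σ] (q : Stmt Γ Λ σ) : (pushedSymbols q).Finite := by
  induction q <;> simp_all [pushedSymbols, Set.finite_range]

/-- The observables of a configuration: the label, the state, and the symbol at
a depth of a stack. -/
def cfgObs (G : Set (Σ k, Γ k)) (c : Cfg Γ Λ σ) : ℕ × (Option Λ ⊕ σ ⊕ G) → Prop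
  | (_, .inl l) => c.l = l
  | (_, .inr (.inl s)) => c.var = s
  | (i, .inr (.inr γ)) => (c.stk γ.1.1)[i]? = some γ.1.2

/-- The observables name only symbols in `G`. They determine a stack entry because every symbol on
the stacks is known to lie in `G`, so an entry without a matching observable is absent. -/
theorem getElem?_eq_of_cfgObs {G : Set (Σ k, Γ k)} {c c' : Cfg Γ Λ σ}
    (hc : ∀ k, ∀ γ ∈ c.stk k, ⟨k, γ⟩ ∈ G) (hc' : ∀ k, ∀ γ ∈ c'.stk k, ⟨k, γ⟩ ∈ G) {j : ℕ}
    (h : ∀ o, (cfgObs G c (j, o) ↔ cfgObs G c' (j, o))) (k : K) :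
    (c.stk k)[j]? = (c'.stk k)[j]? := by
  ext γ
  constructor
  · intro hγ
    exact (h (.inr (.inr ⟨⟨k, γ⟩, hc k γ (List.mem_of_getElem? hγ)⟩))).1 hγ
  · intro hγ
    exact (h (.inr (.inr ⟨⟨k, γ⟩, hc' k γ (List.mem_of_getElem? hγ)⟩))).2 hγ

variable [DecidableEq K]

/-- Each push or pop shifts a stack by one, so the entry at depth `i` comes from a depth at distance
at most `stackOps q`, unless it was pushed. Control depends on the tops that are read, which
originally lie at depths below `stackOps q`. -/
theorem stepAux_local (q : Stmt Γ Λ σ) (v : σ) (S S' : ∀ k, List (Γ k)) (i : ℕ)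
    (h : ∀ j, j < stackOps q ∨ (i ≤ j + stackOps q ∧ j ≤ i + stackOps q) →
      ∀ k, (S k)[j]? = (S' k)[j]?) :
    (stepAux q v S).l = (stepAux q v S').l ∧ (stepAux q v S).var = (stepAux q v S').var ∧
      ∀ k, ((stepAux q v S).stk k)[i]? = ((stepAux q v S').stk k)[i]? := by
  induction q generalizing v S S' with
  | push k f q ih =>
    simp only [stackOps] at h
    refine ih v _ _ fun j hj k' => ?_
    by_cases hk : k' = k
    · subst hk
      cases j with
      | zero => simp
      | succ j => simpa using h j (by omega) k'
    · simpa [hk] using h j (by omega) k'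
  | peek k f q ih =>
    simp only [stackOps] at h
    have h0 : (S k).head? = (S' k).head? := by
      simpa [List.head?_eq_getElem?] using h 0 (by omega) k
    simp only [stepAux, h0]
    exact ih _ _ _ fun j hj k' => h j (by omega) k'
  | pop k f q ih =>
    simp only [stackOps] at h
    have h0 : (S k).head? = (S' k).head? := by
      simpa [List.head?_eq_getElem?] using h 0 (by omega) k
    simp only [stepAux, h0]
    refine ih _ _ _ fun j hj k' => ?_
    by_cases hk : k' = k
    · subst hk
      simpa using h (j + 1) (by omega) k'
    · simpa [hk] using h j (by omega) k'
  | load f q ih => exact ih _ _ _ h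
  | branch f q₁ q₂ ih₁ ih₂ =>
    simp only [stackOps] at h
    simp only [stepAux]
    cases f v
    · exact ih₂ _ _ _ fun j hj => h j (by omega)
    · exact ih₁ _ _ _ fun j hj => h j (by omega)
  | goto f => exact ⟨rfl, rfl, h i (by simp)⟩
  | halt => exact ⟨rfl, rfl, h i (by simp)⟩

theorem stepAux_symbols {G : Set (Σ k, Γ k)} (q : Stmt Γ Λ σ) (hq : pushedSymbols q ⊆ G) (v : σ)
    (S : ∀ k, List (Γ k)) (hS : ∀ k, ∀ γ ∈ S k, ⟨k, γ⟩ ∈ G) :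
    ∀ k, ∀ γ ∈ (stepAux q v S).stk k, ⟨k, γ⟩ ∈ G := by
  induction q generalizing v S with
  | push k f q ih =>
    refine ih (fun _ ha => hq (Or.inr ha)) _ _ fun k' γ hγ => ?_
    by_cases hk : k' = k
    · subst hk
      simp only [Function.update_self, List.mem_cons] at hγ
      rcases hγ with rfl | hγ
      · exact hq (Or.inl ⟨v, rfl⟩)
      · exact hS _ _ hγ
    · exact hS _ _ (by simpa [hk] using hγ)
  | peek k f q ih => exact ih hq _ _ hS
  | pop k f q ih =>
    refine ih hq _ _ fun k' γ hγ => ?_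
    by_cases hk : k' = k
    · subst hk
      exact hS _ _ (List.mem_of_mem_tail (by simpa using hγ))
    · exact hS _ _ (by simpa [hk] using hγ)
  | load f q ih => exact ih hq _ _ hS
  | branch f q₁ q₂ ih₁ ih₂ =>
    simp only [stepAux]
    cases f v
    · exact ih₂ (fun _ ha => hq (Or.inr ha)) _ _ hS
    · exact ih₁ (fun _ ha => hq (Or.inl ha)) _ _ hS
  | goto f => exact hS
  | halt => exact hS

/-- One step of a machine that stays in its configuration after halting. -/
def totalStep (M : Λ → Stmt Γ Λ σ) (c : Cfg Γ Λ σ) : Cfg Γ Λ σ := (step M c).getD c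

theorem cfgObs_totalStep_local {G : Set (Σ k, Γ k)} (M : Λ → Stmt Γ Λ σ) (n : ℕ)
    (hn : ∀ l, stackOps (M l) ≤ n) (c c' : Cfg Γ Λ σ)
    (hc : ∀ k, ∀ γ ∈ c.stk k, ⟨k, γ⟩ ∈ G) (hc' : ∀ k, ∀ γ ∈ c'.stk k, ⟨k, γ⟩ ∈ G) (i : ℕ)
    (h : ∀ j, j < n ∨ (i ≤ j + n ∧ j ≤ i + n) → ∀ o, (cfgObs G c (j, o) ↔ cfgObs G c' (j, o)))
    (o : Option Λ ⊕ σ ⊕ G) :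
    cfgObs G (totalStep M c) (i, o) ↔ cfgObs G (totalStep M c') (i, o) := by
  have hi := h i (by omega)
  have hl : c'.l = c.l := (hi (.inl c.l)).1 rfl
  have hs : c'.var = c.var := (hi (.inr (.inl c.var))).1 rfl
  have hstk : ∀ j, j < n ∨ (i ≤ j + n ∧ j ≤ i + n) → ∀ k, (c.stk k)[j]? = (c'.stk k)[j]? :=
    fun j hj => getElem?_eq_of_cfgObs hc hc' (h j hj)
  rcases c with ⟨_ | l, v, S⟩ <;> rcases c' with ⟨l', v', S'⟩ <;> cases hl <;> cases hs
  · exact hi o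
  · have hl := hn l
    obtain ⟨h1, h2, h3⟩ := stepAux_local (M l) v S S' i fun j hj => hstk j (by omega)
    simp only [totalStep, step, Option.getD_some]
    rcases o with o | o | ⟨⟨k, γ⟩, hγ⟩
    · simp only [cfgObs, h1]
    · simp only [cfgObs, h2]
    · simp only [cfgObs, h3]

theorem totalStep_symbols {G : Set (Σ k, Γ k)} (M : Λ → Stmt Γ Λ σ)
    (hM : ∀ l, pushedSymbols (M l) ⊆ G) (c : Cfg Γ Λ σ) (hc : ∀ k, ∀ γ ∈ c.stk k, ⟨k, γ⟩ ∈ G) :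
    ∀ k, ∀ γ ∈ (totalStep M c).stk k, ⟨k, γ⟩ ∈ G := by
  rcases c with ⟨_ | l, v, S⟩
  · exact hc
  · exact stepAux_symbols (M l) (hM l) v S hc

/-- A halted configuration is a fixed point of `totalStep`. Computations of different durations can
thus be padded to one common time bound, as a tableau of fixed height requires. -/
theorem iterate_totalStep (M : Λ → Stmt Γ Λ σ) {s T : ℕ} (hsT : s ≤ T) {c d : Cfg Γ Λ σ}
    (h : (flip bind (step M))^[s] (some c) = some d) (hd : d.l = none) :
    (totalStep M)^[T] c = d := by
  have none_iter : ∀ s, (flip bind (step M))^[s] none = none := by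
    intro s
    induction s with
    | zero => rfl
    | succ s ih => rw [Function.iterate_succ_apply]; exact ih
  have hd' : totalStep M d = d := by
    rcases d with ⟨_ | l, v, S⟩
    · rfl
    · cases hd
  have h1 : (totalStep M)^[s] c = d := by
    clear hsT
    induction s generalizing c with
    | zero => simpa using h
    | succ s ih =>
      rw [Function.iterate_succ_apply] at h ⊢
      change (flip bind (step M))^[s] (step M c) = some d at h
      cases hc : step M c with
      | none => rw [hc, none_iter] at h; cases h
      | some c' =>
        rw [hc] at h
        have : totalStep M c = c' := by simp [totalStep, hc]
        rw [this]
        exact ih h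
  obtain ⟨r, rfl⟩ := Nat.exists_eq_add_of_le' hsT
  rw [Function.iterate_add_apply, h1, Function.iterate_fixed hd']

end StackMachine

/-- A function of bit strings that is computable in polynomial time is described, on the strings of
each length, by a formula of polynomial size with auxiliary atoms. -/
theorem PolyTimeDecidable.exists_form {L : List Bool → Bool} (hL : PolyTimeDecidable L) :
    ∃ (Gate : Type) (q : Polynomial ℕ), ∀ u : ℕ, ∃ (φ : Form (ℕ ⊕ Gate)) (out : Gate),
      φ.len ≤ q.eval u ∧
      ∀ x : ℕ → Bool, (∃ g, φ.Holds (Sum.elim (fun i => x i = true) g)) ∧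
        ∀ g, φ.Holds (Sum.elim (fun i => x i = true) g) →
          (g out ↔ L ((List.range u).map x) = true) := by
  classical
  obtain ⟨M⟩ := hL
  have := M.tm.ΛFin
  have := M.tm.σFin
  have := M.tm.kFin
  let κ₀ : M.tm.Γ M.tm.k₁ := M.outputAlphabet.symm true
  -- A finite set containing every symbol that can be input or pushed, whatever the size of the
  -- stack alphabets. The output symbol for `true` is added so that it is certainly an observable.
  let G : Set (Σ k, M.tm.Γ k) := (⋃ l, pushedSymbols (M.tm.m l)) ∪
    (Set.range fun b => ⟨M.tm.k₀, M.inputAlphabet.symm b⟩) ∪ {⟨M.tm.k₁, κ₀⟩}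
  have hG : G.Finite := ((Set.finite_iUnion fun l => finite_pushedSymbols _).union
    (Set.finite_range _)).union (Set.finite_singleton _)
  have : Fintype G := hG.fintype
  let n := ∑ l, stackOps (M.tm.m l)
  let kinds := Fintype.card (Option M.tm.Λ ⊕ M.tm.σ ⊕ G)
  -- The polynomial is the tableau bound with the running time as number of steps; `n` and `kinds`
  -- depend on the machine alone.
  refine ⟨ℕ × ℕ × (Option M.tm.Λ ⊕ M.tm.σ ⊕ G),
    (M.time + 1) * ((.C n * M.time + 1) * .C kinds) *
      .C (18 * 2 ^ ((3 * n + 1) * kinds + 1) + 6) + 2, fun u => ?_⟩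
  let init : (ℕ → Prop) → Turing.TM2.Cfg M.tm.Γ M.tm.Λ M.tm.σ := fun x =>
    Turing.initList M.tm ((List.range u).map fun i => M.inputAlphabet.symm (decide (x i)))
  have init_stk : ∀ x, (init x).stk M.tm.k₀ =
      (List.range u).map fun i => M.inputAlphabet.symm (decide (x i)) := fun x => by
    simp [init, Turing.initList]
  have init_stk_ne : ∀ x k, k ≠ M.tm.k₀ → (init x).stk k = [] := fun x k hk => by
    simp [init, Turing.initList, hk]
  obtain ⟨φ, hφ, h⟩ := exists_form_iterate (cfgObs G) (totalStep M.tm.m)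
    (fun c => ∀ k, ∀ γ ∈ c.stk k, ⟨k, γ⟩ ∈ G)
    (totalStep_symbols M.tm.m fun l _ ha => Or.inl (Or.inl (Set.mem_iUnion.2 ⟨l, ha⟩))) n
    (cfgObs_totalStep_local M.tm.m n fun l =>
      Finset.single_le_sum (f := fun l => stackOps (M.tm.m l)) (fun _ _ => Nat.zero_le _)
        (Finset.mem_univ l)) init
    (fun x k γ hγ => by
      by_cases hk : k = M.tm.k₀
      · subst hk
        rw [init_stk] at hγ
        obtain ⟨i, -, rfl⟩ := List.mem_map.1 hγ
        exact Or.inl (Or.inr ⟨_, rfl⟩)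
      · simp [init_stk_ne x k hk] at hγ)
    (fun x y i hxy o => by
      rcases o with o | o | ⟨⟨k, γ⟩, hγ⟩
      · exact Iff.rfl
      · exact Iff.rfl
      · simp only [cfgObs]
        by_cases hk : k = M.tm.k₀
        · subst hk
          rw [init_stk, init_stk]
          rcases lt_or_ge i u with hi | hi <;> simp [hi, hxy]
        · rw [init_stk_ne x k hk, init_stk_ne y k hk])
    (M.time.eval u) (.inr (.inr ⟨⟨M.tm.k₁, κ₀⟩, Or.inr rfl⟩))
  refine ⟨φ, _, by simpa [kinds, -Fintype.card_sum] using hφ,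
    fun x => ⟨(h _).1, fun g hg => ((h _).2 g hg).trans ?_⟩⟩
  have hinit : init (fun i => x i = true) =
      Turing.initList M.tm (((List.range u).map x).map M.inputAlphabet.invFun) := by
    simp only [init, List.map_map]
    congr 2
    funext i
    simp
  obtain ⟨⟨s, hs⟩, hsT⟩ := M.outputsFun ((List.range u).map x)
  have hfin := iterate_totalStep M.tm.m (T := M.time.eval u) (c := init fun i => x i = true)
    (d := Turing.haltList M.tm ((Computability.encodeBool (L ((List.range u).map x))).map
      M.outputAlphabet.invFun)) (by simpa using hsT) (by rw [hinit]; exact hs) rfl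
  rw [hfin]
  simp only [cfgObs, Turing.haltList, κ₀]
  -- `encodeBool` gives a one-letter output, so the top of the output stack is `κ₀` exactly when the
  -- answer is `true`.
  cases L ((List.range u).map x) <;> simp [Computability.encodeBool, List.pure_def]

/-! ### Var-equivalence and faithfulness -/

theorem entails_Cn {Γ : Set PForm} {φ : PForm} : Entails (Cn Γ) φ ↔ Entails Γ φ :=
  ⟨fun h v hv => h v fun _ hψ => hψ v hv, fun h _ hv => hv φ h⟩

theorem DefaultTheory.base_subset_vars {T : DefaultTheory} {P : List Default}
    (hP : ∀ d ∈ P, d ∈ T.D) {φ : PForm} (hφ : φ ∈ T.base P) : φ.atoms ⊆ T.vars := by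
  intro n hn
  rcases hφ with hφ | ⟨d, hd, rfl⟩
  · exact Or.inl ⟨φ, hφ, hn⟩
  · exact Or.inr ⟨d, hP d hd, Or.inr hn⟩

theorem VarEquiv.symm {X : Set ℕ} {Γ Δ : Set PForm} (h : VarEquiv X Γ Δ) : VarEquiv X Δ Γ :=
  fun φ hφ => (h φ hφ).symm

theorem VarEquiv.trans {X : Set ℕ} {Γ Δ Θ : Set PForm} (h : VarEquiv X Γ Δ)
    (h' : VarEquiv X Δ Θ) : VarEquiv X Γ Θ :=
  fun φ hφ => (h φ hφ).trans (h' φ hφ)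

/-- Extensions of a theory that are var-equivalent with respect to all of its variables
are equal. -/
theorem Semantics.eq_of_varEquiv {S : Semantics} {T : DefaultTheory} {E E' : Set PForm}
    (hE : E ∈ S.extensions T) (hE' : E' ∈ S.extensions T) (h : VarEquiv T.vars E E') : E = E' := by
  have key : ∀ {E E' : Set PForm}, E ∈ S.extensions T → E' ∈ S.extensions T →
      VarEquiv T.vars E E' → E ⊆ E' := by
    rintro _ _ ⟨P, hP, -, -, rfl⟩ ⟨P', -, -, -, rfl⟩ h φ hφ v hv
    refine hφ v fun ψ hψ => ?_
    have h1 := (h ψ (DefaultTheory.base_subset_vars hP.mem hψ)).1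
      (entails_Cn.2 fun _ hv => hv ψ hψ)
    exact entails_Cn.1 h1 v hv
  exact (key hE hE' h).antisymm (key hE' hE h.symm)

/-- A translation is faithful if extensions match up to var-equivalence in both directions. -/
theorem faithful_of_varEquiv {S S' : Semantics} {T T' : DefaultTheory}
    (h : ∀ E ∈ S.extensions T, ∃ E' ∈ S'.extensions T', VarEquiv T.vars E E')
    (h' : ∀ E' ∈ S'.extensions T', ∃ E ∈ S.extensions T, VarEquiv T.vars E E') :
    Faithful S S' T T' := by
  choose f hf hfE using h
  have iff_equiv : ∀ (E : S.extensions T) (E' : S'.extensions T'),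
      (Quotient.mk (varSetoid T.vars (S'.extensions T')) ⟨f E E.2, hf E E.2⟩ = Quotient.mk _ E' ↔
        VarEquiv T.vars (E : Set PForm) (E' : Set PForm)) := fun E E' =>
    Quotient.eq.trans ⟨fun h => (hfE E E.2).trans h, fun h => (hfE E E.2).symm.trans h⟩
  refine ⟨fun E => Quotient.mk _ ⟨f E E.2, hf E E.2⟩, ⟨fun E₁ E₂ h => ?_, fun Q => ?_⟩, iff_equiv⟩
  · exact Subtype.ext (Semantics.eq_of_varEquiv E₁.2 E₂.2
      (((iff_equiv E₁ _).1 h).trans (hfE E₂ E₂.2).symm))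
  · induction Q using Quotient.inductionOn with
    | h E' =>
      obtain ⟨E, hE, hEE'⟩ := h' E' E'.2
      exact ⟨⟨E, hE⟩, (iff_equiv ⟨E, hE⟩ E').2 hEE'⟩

/-! ### Normal theories that guess the values of atoms -/

/-- The normal default without precondition that has the given consequence. -/
def Default.free (φ : PForm) : Default := ⟨Form.verum, φ, φ⟩

open Classical in
/-- The consequences available to a theory that guesses the value of the atoms in `G` and
makes as many atoms in `S` true as possible. -/
noncomputable def guesses (G S : Finset ℕ) : Finset PForm :=
  G.image Form.atom ∪ G.image (fun a => .neg (.atom a)) ∪ S.image Form.atom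

open Classical in
/-- The normal theory that guesses the value of the atoms in `G` and makes as many atoms in `S`
true as possible, under the constraint `Ω`. -/
noncomputable def guessTheory (Ω : PForm) (G S : Finset ℕ) (h : ∃ v, Ω.Holds v) :
    DefaultTheory where
  D := (guesses G S).image Default.free
  W := {Ω}
  consistent := by simpa [Consistent] using h

/-- A model of `Ω` that satisfies every atom in `S` that is true in some model with
the same values on `G`. -/
structure IsMaxModel {α : Type} (Ω : Form α) (G S : Finset α) (v : α → Prop) : Prop where
  holds : Ω.Holds v
  max : ∀ w, Ω.Holds w → (∀ a ∈ G, (w a ↔ v a)) → ∀ a ∈ S, w a → v a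

/-- A valuation can be transported along a renaming that is injective on the relevant atoms. -/
theorem exists_valuation_of_injOn {α : Type} {code : α → ℕ} {F : Set α} (hF : Set.InjOn code F)
    (w : α → Prop) : ∃ v : ℕ → Prop, ∀ a ∈ F, (v (code a) ↔ w a) := by
  refine ⟨fun n => ∃ a ∈ F, code a = n ∧ w a, fun a ha => ⟨?_, fun h => ⟨a, ha, rfl, h⟩⟩⟩
  rintro ⟨a', ha', h, hw⟩
  rwa [← hF ha' ha h]

open Classical in
theorem isMaxModel_map {α : Type} {Ω : Form α} {G S : Finset α} {code : α → ℕ} {F : Set α}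
    (hF : Set.InjOn code F) (hΩ : Ω.atoms ⊆ F) (hG : ∀ a ∈ G, a ∈ F) (hS : ∀ a ∈ S, a ∈ F)
    {v : ℕ → Prop} : IsMaxModel (Ω.map code) (G.image code) (S.image code) v ↔
      IsMaxModel Ω G S fun a => v (code a) := by
  constructor
  · rintro ⟨h, hmax⟩
    refine ⟨(Form.holds_map _ _ _).1 h, fun w hw hwG a ha hwa => ?_⟩
    obtain ⟨v', hv'⟩ := exists_valuation_of_injOn hF w
    refine hmax v' ((Form.holds_map _ _ _).2 ((Form.holds_congr fun a ha => hv' a (hΩ ha)).2 hw))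
      ?_ (code a) (Finset.mem_image_of_mem _ ha) ((hv' a (hS a ha)).2 hwa)
    simp only [Finset.forall_mem_image]
    exact fun c hc => (hv' c (hG c hc)).trans (hwG c hc)
  · rintro ⟨h, hmax⟩
    refine ⟨(Form.holds_map _ _ _).2 h, fun w hw hwG => ?_⟩
    simp only [Finset.forall_mem_image] at hwG ⊢
    exact fun a => hmax _ ((Form.holds_map _ _ _).1 hw) (fun a ha => hwG ha) a

/-! ### Reiter extensions of a guessing theory -/

section GuessTheory

variable {Ω : PForm} {G S : Finset ℕ} {h : ∃ v, Ω.Holds v}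

theorem guessTheory_isNormal : (guessTheory Ω G S h).IsNormal := by
  classical
  intro d hd
  obtain ⟨φ, -, rfl⟩ := Finset.mem_image.1 hd
  rfl

theorem mem_guesses {φ : PForm} : φ ∈ guesses G S ↔
    (∃ a ∈ G, φ = .atom a) ∨ (∃ a ∈ G, φ = .neg (.atom a)) ∨ ∃ a ∈ S, φ = .atom a := by
  simp [guesses, eq_comm]

theorem mem_guessTheory_D {d : Default} :
    d ∈ (guessTheory Ω G S h).D ↔ ∃ φ ∈ guesses G S, d = Default.free φ := by
  simp [guessTheory, eq_comm]

theorem models_guessTheory_base {P : List Default} {v : ℕ → Prop} :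
    (∀ φ ∈ (guessTheory Ω G S h).base P, φ.Holds v) ↔ Ω.Holds v ∧ ∀ d ∈ P, d.cons.Holds v := by
  simp only [DefaultTheory.base, guessTheory, Finset.mem_singleton, Set.mem_union,
    Set.mem_ofPred_eq]
  constructor
  · exact fun H => ⟨H Ω (Or.inl rfl), fun d hd => H _ (Or.inr ⟨d, hd, rfl⟩)⟩
  · rintro ⟨H, H'⟩ φ (rfl | ⟨d, hd, rfl⟩)
    exacts [H, H' d hd]

/-- No default makes an atom of `S` false. Once the atoms of `G` are fixed, maximality of `v`
prevents a model from having more true atoms of `S` than `v`, and the defaults in `P` prevent it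
from having fewer. -/
theorem IsMaxModel.models_base {v : ℕ → Prop} (hv : IsMaxModel Ω G S v) {P : List Default}
    (hP : ∀ d ∈ P, d ∈ (guessTheory Ω G S h).D)
    (hPv : ∀ d ∈ (guessTheory Ω G S h).D, d.cons.Holds v ↔ d ∈ P) {w : ℕ → Prop} :
    (∀ φ ∈ (guessTheory Ω G S h).base P, φ.Holds w) ↔
      Ω.Holds w ∧ ∀ a ∈ G ∪ S, (w a ↔ v a) := by
  rw [models_guessTheory_base]
  refine and_congr_right fun hw => ⟨fun H => ?_, fun H d hd => ?_⟩
  · have agree : ∀ φ ∈ guesses G S, φ.Holds v → φ.Holds w := fun φ hφ hφv =>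
      H (Default.free φ) ((hPv _ (mem_guessTheory_D.2 ⟨φ, hφ, rfl⟩)).1 hφv)
    have agreeG : ∀ a ∈ G, (w a ↔ v a) := by
      intro a ha
      by_cases hva : v a
      · exact iff_of_true (agree (.atom a) (mem_guesses.2 (Or.inl ⟨a, ha, rfl⟩)) hva) hva
      · exact iff_of_false
          (agree (.neg (.atom a)) (mem_guesses.2 (Or.inr (Or.inl ⟨a, ha, rfl⟩))) hva) hva
    intro a ha
    rcases Finset.mem_union.1 ha with ha | ha
    · exact agreeG a ha
    · exact ⟨hv.max w hw agreeG a ha,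
        agree (.atom a) (mem_guesses.2 (Or.inr (Or.inr ⟨a, ha, rfl⟩)))⟩
  · have hdv := (hPv d (hP d hd)).2 hd
    obtain ⟨φ, hφ, rfl⟩ := mem_guessTheory_D.1 (hP d hd)
    rcases mem_guesses.1 hφ with ⟨a, ha, rfl⟩ | ⟨a, ha, rfl⟩ | ⟨a, ha, rfl⟩
    · exact (H a (Finset.mem_union_left _ ha)).2 hdv
    · exact (not_congr (H a (Finset.mem_union_left _ ha))).2 hdv
    · exact (H a (Finset.mem_union_right _ ha)).2 hdv

/-- The extensions of a guessing theory are given by the maximal models. -/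
theorem extensions_guessTheory
    (hmax : ∀ v₀, Ω.Holds v₀ → ∃ v, IsMaxModel Ω G S v ∧ ∀ a ∈ G, (v a ↔ v₀ a)) :
    reiter.extensions (guessTheory Ω G S h) = {E | ∃ v, IsMaxModel Ω G S v ∧
      E = {φ | ∀ w, Ω.Holds w → (∀ a ∈ G ∪ S, (w a ↔ v a)) → φ.Holds w}} := by
  classical
  have eq_of : ∀ {v : ℕ → Prop} (_ : IsMaxModel Ω G S v) {P : List Default}
      (_ : ∀ d ∈ P, d ∈ (guessTheory Ω G S h).D)
      (_ : ∀ d ∈ (guessTheory Ω G S h).D, d.cons.Holds v ↔ d ∈ P),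
      Cn ((guessTheory Ω G S h).base P) =
        {φ | ∀ w, Ω.Holds w → (∀ a ∈ G ∪ S, (w a ↔ v a)) → φ.Holds w} := by
    intro v hv P hP hPv
    ext φ
    refine forall_congr' fun w => ?_
    rw [hv.models_base hP hPv, and_imp]
  ext E
  constructor
  · rintro ⟨P, hP, -, hclosed, rfl⟩
    obtain ⟨v₀, hv₀⟩ := hP.consistent
    rw [models_guessTheory_base] at hv₀
    -- Signals may have been set in any order relative to the guesses. Passing to a maximal model
    -- with the same guess keeps all consequences in `P` true, and closure then puts every default
    -- that is true in `v` into `P`.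
    obtain ⟨v, hv, hvv₀⟩ := hmax v₀ hv₀.1
    have hcons : ∀ φ ∈ guesses G S, φ.Holds v₀ → φ.Holds v := by
      intro φ hφ hφv
      rcases mem_guesses.1 hφ with ⟨a, ha, rfl⟩ | ⟨a, ha, rfl⟩ | ⟨a, ha, rfl⟩
      · exact (hvv₀ a ha).2 hφv
      · exact (not_congr (hvv₀ a ha)).2 hφv
      · exact hv.max v₀ hv₀.1 (fun b hb => (hvv₀ b hb).symm) a ha hφv
    have hPv : ∀ d ∈ P, d.cons.Holds v := by
      intro d hd
      obtain ⟨φ, hφ, rfl⟩ := mem_guessTheory_D.1 (hP.mem d hd)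
      exact hcons φ hφ (hv₀.2 _ hd)
    refine ⟨v, hv, eq_of hv hP.mem fun d hd => ⟨fun hdv => ?_, hPv d⟩⟩
    by_contra hdP
    obtain ⟨φ, -, rfl⟩ := mem_guessTheory_D.1 hd
    rcases hclosed _ hd hdP with hc | hc
    · exact hc fun w _ => Form.holds_verum w
    · refine hc ⟨v, fun ψ hψ => ?_⟩
      rcases hψ with hψ | rfl
      · exact models_guessTheory_base.2 ⟨hv.holds, hPv⟩ ψ hψ
      · exact hdv
  · rintro ⟨v, hv, rfl⟩
    let P := ((guessTheory Ω G S h).D.filter fun d => d.cons.Holds v).toList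
    have hPD : ∀ d ∈ P, d ∈ (guessTheory Ω G S h).D := by simp +contextual [P]
    have hP : ∀ d ∈ (guessTheory Ω G S h).D, d.cons.Holds v ↔ d ∈ P := by
      simp +contextual [P]
    have hvP : ∀ φ ∈ (guessTheory Ω G S h).base P, φ.Holds v :=
      (hv.models_base hPD hP).2 ⟨hv.holds, fun _ _ => Iff.rfl⟩
    refine ⟨P, ⟨hPD, Finset.nodup_toList _, ⟨v, hvP⟩, fun P₁ P₂ d hd => ?_⟩, fun d hd => ?_,
      fun d hd hdP => Or.inr ?_, (eq_of hv hPD hP).symm⟩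
    · obtain ⟨φ, -, rfl⟩ := mem_guessTheory_D.1 (hPD d (by rw [hd]; simp))
      exact fun w _ => Form.holds_verum w
    · obtain ⟨φ, -, rfl⟩ := mem_guessTheory_D.1 (hPD d hd)
      refine ⟨v, fun ψ hψ => ?_⟩
      rcases hψ with hψ | rfl
      · exact hvP ψ hψ
      · exact (hP _ (hPD _ hd)).2 hd
    -- All models of the base agree with `v` on `G ∪ S`, so a default that can still be added has a
    -- consequence true in `v` and is already in `P`.
    · rintro ⟨w, hw⟩
      have hwv := ((hv.models_base hPD hP).1 fun ψ hψ => hw ψ (Or.inl hψ)).2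
      have hdw : d.just.Holds w := hw _ (Or.inr rfl)
      refine hdP ((hP d hd).1 ?_)
      obtain ⟨φ, hφ, rfl⟩ := mem_guessTheory_D.1 hd
      refine (Form.holds_congr fun a ha => ?_).1 hdw
      refine hwv a ?_
      change a ∈ φ.atoms at ha
      rcases mem_guesses.1 hφ with ⟨b, hb, rfl⟩ | ⟨b, hb, rfl⟩ | ⟨b, hb, rfl⟩ <;>
        cases ha <;> simp [hb]

end GuessTheory

/-! ### Checking by consistency tests that a set of defaults is a process -/

/-- The elements of a finite set can be listed in accordance with a strict partial order. -/
theorem exists_list_of_order {α : Type} [DecidableEq α] (r : α → α → Prop) (A : Finset α)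
    (irrefl : ∀ a ∈ A, ¬ r a a)
    (trans : ∀ a ∈ A, ∀ b ∈ A, ∀ c ∈ A, r a b → r b c → r a c) :
    ∃ P : List α, P.Nodup ∧ (∀ a, a ∈ P ↔ a ∈ A) ∧
      ∀ P₁ P₂ a, P = P₁ ++ a :: P₂ → ∀ b ∈ A, r b a → b ∈ P₁ := by
  classical
  induction A using Finset.strongInduction with
  | H A ih =>
    rcases A.eq_empty_or_nonempty with rfl | hA
    · exact ⟨[], by simp⟩
    -- By transitivity an element with the most predecessors has no successor in `A`, so it can be
    -- listed last.
    obtain ⟨a, ha, hmax⟩ := A.exists_max_image (fun a => (A.filter fun b => r b a).card) hA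
    have hmax' : ∀ c ∈ A, ¬ r a c := by
      intro c hc hac
      refine (hmax c hc).not_gt (Finset.card_lt_card (Finset.ssubset_iff_of_subset ?_ |>.2 ?_))
      · intro b hb
        rw [Finset.mem_filter] at hb ⊢
        exact ⟨hb.1, trans b hb.1 a ha c hc hb.2 hac⟩
      · exact ⟨a, Finset.mem_filter.2 ⟨ha, hac⟩, fun h => irrefl a ha (Finset.mem_filter.1 h).2⟩
    obtain ⟨P, hnd, hmem, hord⟩ := ih (A.erase a) (Finset.erase_ssubset ha)
      (fun b hb => irrefl b (Finset.mem_of_mem_erase hb))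
      (fun b hb c hc d hd => trans b (Finset.mem_of_mem_erase hb) c (Finset.mem_of_mem_erase hc) d
        (Finset.mem_of_mem_erase hd))
    refine ⟨P ++ [a], ?_, fun b => ?_, fun P₁ P₂ d hd b hb hbd => ?_⟩
    · rw [List.nodup_append]
      refine ⟨hnd, List.nodup_singleton a, fun b hb c hc => ?_⟩
      rw [List.mem_singleton] at hc
      rw [hc]
      exact Finset.ne_of_mem_erase ((hmem b).1 hb)
    · by_cases hba : b = a <;> simp [hmem, hba, ha]
    · rcases List.eq_nil_or_concat P₂ with rfl | ⟨P₂', c, rfl⟩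
      · obtain ⟨rfl, h⟩ := List.append_inj' hd rfl
        cases h
        refine (hmem b).2 (Finset.mem_erase.2 ⟨?_, hb⟩)
        rintro rfl
        exact irrefl _ hb hbd
      · rw [List.concat_eq_append, ← List.cons_append, ← List.append_assoc] at hd
        obtain ⟨h, h'⟩ := List.append_inj' hd rfl
        cases h'
        have hdA : d ∈ A := Finset.mem_of_mem_erase ((hmem d).1 (by rw [h]; simp))
        refine hord P₁ P₂' d h b (Finset.mem_erase.2 ⟨?_, hb⟩) hbd
        rintro rfl
        exact hmax' d hdA hbd

/-- The atoms of the tests: the variables, the propositions `d ∈ Π`, and the propositions that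
a default precedes another one. -/
abbrev GuessAtom : Type := ℕ ⊕ Default ⊕ Default × Default

/-- The valuation of the atoms of the tests given by a valuation of the variables, a set of
defaults and a relation on defaults. -/
def guessVal (m : Default → Prop) (b : Default → Default → Prop) (x : ℕ → Prop) :
    GuessAtom → Prop :=
  Sum.elim x (Sum.elim m fun p => b p.1 p.2)

/-- A test is satisfiable for the given guess. -/
def Passes (m : Default → Prop) (b : Default → Default → Prop) (ω : Form GuessAtom) : Prop :=
  ∃ x, ω.Holds (guessVal m b x)

/-- The proposition that a default is in the process. -/
abbrev memAtom (d : Default) : Form GuessAtom := .atom (.inr (.inl d))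

/-- The proposition that a default precedes another one. -/
abbrev befAtom (d e : Default) : Form GuessAtom := .atom (.inr (.inr (d, e)))

/-- A test formula as a formula over the atoms of the tests. -/
def ofTest (ω : TestForm) : Form GuessAtom := ω.map (Sum.elim .inl fun d => .inr (.inl d))

namespace DefaultTheory

variable (T : DefaultTheory)

/-- The background theory as a formula. -/
noncomputable def background : PForm := .conjList T.W.toList

/-- The test that the guessed consequences are consistent and the guessed relation is a strict
partial order. -/
noncomputable def goodTest : Form GuessAtom :=
  .conj (T.background.map .inl) <|
  .conj (.conjList (T.D.toList.map fun d => .imp (memAtom d) (d.cons.map .inl))) <|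
  .conj (.conjList (T.D.toList.map fun d => .neg (befAtom d d))) <|
  .conjList ((T.D.toList ×ˢ (T.D.toList ×ˢ T.D.toList)).map fun p =>
    .imp (.conj (befAtom p.1 p.2.1) (befAtom p.2.1 p.2.2)) (befAtom p.1 p.2.2))

/-- The test that the precondition of some guessed default does not follow from the background
theory and the consequences of the preceding defaults. -/
noncomputable def badTest : Form GuessAtom :=
  .conj (T.background.map .inl) <|
  .disjList (T.D.toList.map fun e => .conj (memAtom e) <| .conj (.neg (e.prec.map .inl)) <|
    .conjList (T.D.toList.map fun d => .imp (.conj (memAtom d) (befAtom d e)) (d.cons.map .inl)))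

variable {T} {m : Default → Prop} {b : Default → Default → Prop} {x : ℕ → Prop}

@[simp] theorem holds_background : T.background.Holds x ↔ ∀ φ ∈ T.W, φ.Holds x := by
  simp [background]

theorem holds_goodTest : T.goodTest.Holds (guessVal m b x) ↔
    (∀ φ ∈ T.W, φ.Holds x) ∧ (∀ d ∈ T.D, m d → d.cons.Holds x) ∧ (∀ d ∈ T.D, ¬ b d d) ∧
      ∀ d ∈ T.D, ∀ e ∈ T.D, ∀ f ∈ T.D, b d e → b e f → b d f := by
  simp only [goodTest, Form.holds_conj, Form.holds_map, holds_background, Form.holds_conjList,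
    List.forall_mem_map, Finset.mem_toList, Form.holds_imp, Form.holds_atom, Form.holds_neg,
    Prod.forall, List.mem_product, guessVal, Sum.elim_inl, Sum.elim_inr]
  refine and_congr_right fun _ => and_congr_right fun _ => and_congr_right fun _ => ?_
  constructor
  · exact fun h d hd e he f hf h1 h2 => h d e f ⟨hd, he, hf⟩ ⟨h1, h2⟩
  · exact fun h d e f hdef h' => h d hdef.1 e hdef.2.1 f hdef.2.2 h'.1 h'.2

theorem holds_badTest : T.badTest.Holds (guessVal m b x) ↔
    (∀ φ ∈ T.W, φ.Holds x) ∧ ∃ e ∈ T.D, m e ∧ ¬ e.prec.Holds x ∧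
      ∀ d ∈ T.D, m d ∧ b d e → d.cons.Holds x := by
  simp only [badTest, Form.holds_conj, Form.holds_map, holds_background, Form.holds_conjList,
    Finset.mem_toList, Form.holds_imp, Form.holds_atom, Form.holds_neg,
    Form.holds_disjList, List.mem_map, exists_exists_and_eq_and, forall_exists_index, and_imp,
    forall_apply_eq_imp_iff₂, guessVal, Sum.elim_inl, Sum.elim_inr]

theorem models_base {P : List Default} :
    (∀ φ ∈ T.base P, φ.Holds x) ↔ (∀ φ ∈ T.W, φ.Holds x) ∧ ∀ d ∈ P, d.cons.Holds x := by
  constructor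
  · exact fun H => ⟨fun φ hφ => H φ (Or.inl hφ), fun d hd => H _ (Or.inr ⟨d, hd, rfl⟩)⟩
  · rintro ⟨H, H'⟩ φ (hφ | ⟨d, hd, rfl⟩)
    exacts [H φ hφ, H' d hd]

/-- A guess that passes the tests can be arranged in a process. -/
theorem exists_isProc_of_tests (hgood : Passes m b T.goodTest) (hbad : ¬ Passes m b T.badTest) :
    ∃ P, T.IsProc P ∧ ∀ d, d ∈ P ↔ d ∈ T.D ∧ m d := by
  classical
  obtain ⟨x, hx⟩ := hgood
  obtain ⟨hW, hcons, hirr, htr⟩ := holds_goodTest.1 hx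
  let A := T.D.filter m
  have hA : ∀ d ∈ A, d ∈ T.D ∧ m d := fun d hd => Finset.mem_filter.1 hd
  obtain ⟨P, hnd, hmem, hord⟩ := exists_list_of_order b A (fun d hd => hirr d (hA d hd).1)
    (fun d hd e he f hf => htr d (hA d hd).1 e (hA e he).1 f (hA f hf).1)
  have hmem' : ∀ d, d ∈ P ↔ d ∈ T.D ∧ m d := fun d => (hmem d).trans Finset.mem_filter
  refine ⟨P, ⟨fun d hd => ((hmem' d).1 hd).1, hnd, ⟨x, models_base.2 ⟨hW, fun d hd => ?_⟩⟩,
    fun P₁ P₂ e he y hy => ?_⟩, hmem'⟩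
  · exact hcons d ((hmem' d).1 hd).1 ((hmem' d).1 hd).2
  · by_contra hprec
    obtain ⟨hyW, hyP⟩ := models_base.1 hy
    obtain ⟨heD, hem⟩ := (hmem' e).1 (by rw [he]; simp)
    -- The test considers only members guessed to precede `e`; the listing places all of them in
    -- `P₁`, so `y` satisfies their consequences.
    exact hbad ⟨y, holds_badTest.2 ⟨hyW, e, heD, hem, hprec, fun d hd hde =>
      hyP d (hord P₁ P₂ e he d (Finset.mem_filter.2 ⟨hd, hde.1⟩) hde.2)⟩⟩

/-- The tests are passed by the guess that describes a process. -/
theorem IsProc.exists_passes {P : List Default} (hP : T.IsProc P) :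
    ∃ b, Passes (· ∈ P) b T.goodTest ∧ ¬ Passes (· ∈ P) b T.badTest := by
  classical
  -- Defaults outside `P` have index `P.length`. The relation is pulled back from `<`, hence a
  -- strict order on all of `T.D`, as `goodTest` demands.
  refine ⟨fun d e => P.idxOf d < P.idxOf e, ?_, ?_⟩
  · obtain ⟨x, hx⟩ := hP.consistent
    obtain ⟨hW, hcons⟩ := models_base.1 hx
    exact ⟨x, holds_goodTest.2 ⟨hW, fun d _ => hcons d, fun d _ => lt_irrefl _,
      fun d _ e _ f _ => lt_trans⟩⟩
  · rintro ⟨x, hx⟩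
    obtain ⟨hW, e, -, he, hprec, hcons⟩ := holds_badTest.1 hx
    obtain ⟨P₁, P₂, rfl⟩ := List.append_of_mem he
    refine hprec (hP.prec P₁ P₂ e rfl x (models_base.2 ⟨hW, fun d hd => ?_⟩))
    refine hcons d (hP.mem d (by simp [hd])) ⟨by simp [hd], ?_⟩
    have he₁ : e ∉ P₁ := fun h => (List.nodup_append.1 hP.nodup).2.2 e h e (by simp) rfl
    rw [List.idxOf_append_of_mem hd, List.idxOf_append_of_notMem he₁]
    have := List.idxOf_lt_length_of_mem hd
    omega

theorem testPasses_iff_passes {P : List Default} (hm : ∀ d ∈ T.D, (m d ↔ d ∈ P)) {ω : TestForm}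
    (hω : TestOver T ω) : TestPasses P ω ↔ Passes m b (ofTest ω) := by
  refine exists_congr fun x => ?_
  rw [ofTest, Form.holds_map]
  refine Form.holds_congr fun a ha => ?_
  rcases a with n | d
  · exact Iff.rfl
  · exact (hm d (hω.2 d ha)).symm

end DefaultTheory

/-! ### The translation -/

/-- The propositions used by the translation: the variables of the theory, copies of them for each
test, the guessed set and order of defaults, the results of the tests, the gates of two circuits,
and the acceptance of the guess. -/
inductive TrAtom (Γ₁ Γ₂ : Type) : Type where
  | var (n : ℕ)
  | copy (i n : ℕ)
  | mem (d : Default)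
  | bef (d e : Default)
  | sig (i : ℕ)
  | gate₁ (g : Γ₁)
  | gate₂ (g : Γ₂)
  | ok

/-- The data for the translation of a theory: the tests for successfulness and closure, circuits
that combine their results, and a process that is used in place of the
guesses that are not accepted. -/
structure TrData (Γ₁ Γ₂ : Type) : Type where
  t₁ : List TestForm
  t₂ : List TestForm
  φ₁ : Form (ℕ ⊕ Γ₁)
  φ₂ : Form (ℕ ⊕ Γ₂)
  out₁ : Γ₁
  out₂ : Γ₂
  fallback : List Default

namespace TrData

variable {Γ₁ Γ₂ : Type} (c : TrData Γ₁ Γ₂) (T : DefaultTheory)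

/-- All tests of the translation. -/
noncomputable def tests : List (Form GuessAtom) :=
  T.goodTest :: T.badTest :: (c.t₁ ++ c.t₂).map ofTest

/-- The atoms of a test as atoms of the translation. -/
def testAtom (i : ℕ) : GuessAtom → TrAtom Γ₁ Γ₂ :=
  Sum.elim (.copy i) (Sum.elim .mem fun p => .bef p.1 p.2)

/-- If a test is claimed to pass, then it is satisfied by its copy of the variables. -/
noncomputable def testsForm : Form (TrAtom Γ₁ Γ₂) :=
  .conjList ((c.tests T).zipIdx.map fun p => .imp (.atom (.sig p.2)) (p.1.map (testAtom p.2)))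

/-- The guess is accepted if it is a process that is successful and closed. -/
def acceptForm : Form (TrAtom Γ₁ Γ₂) :=
  -- Indices 0 and 1 belong to `goodTest` and `badTest`; the tests in `t₁` start at 2 and those in
  -- `t₂` follow them.
  .conj (c.φ₁.map (Sum.elim (fun i => .sig (i + 2)) .gate₁)) <|
  .conj (c.φ₂.map (Sum.elim (fun i => .sig (i + c.t₁.length + 2)) .gate₂)) <|
  .iff (.atom .ok) <| .conj (.atom (.gate₁ c.out₁)) <| .conj (.atom (.gate₂ c.out₂)) <|
    .conj (.atom (.sig 0)) (.neg (.atom (.sig 1)))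

/-- The consequences of the process that has been guessed, or of the fallback process. -/
noncomputable def releaseForm : Form (TrAtom Γ₁ Γ₂) :=
  .conj (T.background.map .var) <|
  .conj (.imp (.atom .ok) <|
    .conjList (T.D.toList.map fun d => .imp (.atom (.mem d)) (d.cons.map .var))) <|
  .imp (.neg (.atom .ok)) <| .conjList (c.fallback.map fun d => d.cons.map .var)

/-- The background theory of the translation. -/
noncomputable def form : Form (TrAtom Γ₁ Γ₂) :=
  .conj (c.testsForm T) (.conj c.acceptForm (c.releaseForm T))

open Classical in
/-- The atoms whose values are guessed. -/
noncomputable def guessed : Finset (TrAtom Γ₁ Γ₂) :=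
  T.D.image .mem ∪ (T.D ×ˢ T.D).image fun p => .bef p.1 p.2

open Classical in
/-- The atoms that signal the results of the tests. -/
noncomputable def signals : Finset (TrAtom Γ₁ Γ₂) :=
  (Finset.range (c.tests T).length).image .sig

variable {c T} {w : TrAtom Γ₁ Γ₂ → Prop}

theorem holds_testsForm : (c.testsForm T).Holds w ↔
    ∀ (i : ℕ) (ω : Form GuessAtom), (c.tests T)[i]? = some ω → w (.sig i) →
      ω.Holds (guessVal (fun d => w (.mem d)) (fun d e => w (.bef d e)) fun n => w (.copy i n)) := by
  have : ∀ i, (fun a => w (testAtom i a)) =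
      guessVal (fun d => w (.mem d)) (fun d e => w (.bef d e)) fun n => w (.copy i n) := by
    intro i
    funext a
    rcases a with n | d | p <;> rfl
  simp only [testsForm, Form.holds_conjList, List.forall_mem_map, Form.holds_imp, Form.holds_atom,
    Form.holds_map, this, Prod.forall, List.mem_zipIdx_iff_getElem?]
  exact ⟨fun h i ω => h ω i, fun h ω i => h i ω⟩

theorem holds_acceptForm : c.acceptForm.Holds w ↔
    c.φ₁.Holds (Sum.elim (fun i => w (.sig (i + 2))) fun g => w (.gate₁ g)) ∧
    c.φ₂.Holds (Sum.elim (fun i => w (.sig (i + c.t₁.length + 2))) fun g => w (.gate₂ g)) ∧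
    (w .ok ↔ w (.gate₁ c.out₁) ∧ w (.gate₂ c.out₂) ∧ w (.sig 0) ∧ ¬ w (.sig 1)) := by
  have h₁ : (fun a => w (Sum.elim (fun i => .sig (i + 2)) .gate₁ a)) =
      Sum.elim (fun i => w (.sig (i + 2))) fun g => w (.gate₁ g) := by
    funext a
    rcases a with i | g <;> rfl
  have h₂ : (fun a => w (Sum.elim (fun i => .sig (i + c.t₁.length + 2)) .gate₂ a)) =
      Sum.elim (fun i => w (.sig (i + c.t₁.length + 2))) fun g => w (.gate₂ g) := by
    funext a
    rcases a with i | g <;> rfl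
  simp only [acceptForm, Form.holds_conj, Form.holds_map, h₁, h₂, Form.holds_iff, Form.holds_atom,
    Form.holds_neg]

/-- The valuations `x` of the variables of the theory that are possible for given values of the
other atoms. -/
def Released (c : TrData Γ₁ Γ₂) (T : DefaultTheory) (w : TrAtom Γ₁ Γ₂ → Prop) (x : ℕ → Prop) :
    Prop :=
  (∀ φ ∈ T.W, φ.Holds x) ∧ (w .ok → ∀ d ∈ T.D, w (.mem d) → d.cons.Holds x) ∧
    (¬ w .ok → ∀ d ∈ c.fallback, d.cons.Holds x)

theorem holds_releaseForm :
    (c.releaseForm T).Holds w ↔ c.Released T w fun n => w (.var n) := by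
  simp only [releaseForm, Form.holds_conj, Form.holds_map, DefaultTheory.holds_background,
    Form.holds_imp, Form.holds_atom, Form.holds_neg, Form.holds_conjList, List.forall_mem_map,
    Finset.mem_toList, Released]

/-- The data fit the theory. -/
structure Valid (c : TrData Γ₁ Γ₂) (S : Semantics) (T : DefaultTheory) (L₁ L₂ : List Bool → Bool) :
    Prop where
  over₁ : ∀ ω ∈ c.t₁, TestOver T ω
  over₂ : ∀ ω ∈ c.t₂, TestOver T ω
  circuit₁ : ∀ x : ℕ → Bool, (∃ g, c.φ₁.Holds (Sum.elim (fun i => x i = true) g)) ∧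
    ∀ g, c.φ₁.Holds (Sum.elim (fun i => x i = true) g) →
      (g c.out₁ ↔ L₁ ((List.range c.t₁.length).map x) = true)
  circuit₂ : ∀ x : ℕ → Bool, (∃ g, c.φ₂.Holds (Sum.elim (fun i => x i = true) g)) ∧
    ∀ g, c.φ₂.Holds (Sum.elim (fun i => x i = true) g) →
      (g c.out₂ ↔ L₂ ((List.range c.t₂.length).map x) = true)
  successful : ∀ P, T.IsProc P → (S.Successful T P ↔ L₁ (testResults P c.t₁) = true)
  closed : ∀ P, T.IsProc P → (S.Closed T P ↔ L₂ (testResults P c.t₂) = true)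
  isProc_fallback : T.IsProc c.fallback
  successful_fallback : S.Successful T c.fallback
  closed_fallback : S.Closed T c.fallback

/-- The results of the tests are those signalled. -/
def Signals (c : TrData Γ₁ Γ₂) (T : DefaultTheory) (w : TrAtom Γ₁ Γ₂ → Prop) : Prop :=
  ∀ (i : ℕ) (ω : Form GuessAtom), (c.tests T)[i]? = some ω →
    (w (.sig i) ↔ Passes (fun d => w (.mem d)) (fun d e => w (.bef d e)) ω)

variable {S : Semantics} {L₁ L₂ : List Bool → Bool}

/-- The tests mention membership and precedence only for defaults in `T.D`, which are exactly the
guessed atoms. Test results are therefore a function of the guess. -/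
theorem Valid.passes_congr (hc : c.Valid S T L₁ L₂) {m m' : Default → Prop}
    {b b' : Default → Default → Prop} (hm : ∀ d ∈ T.D, (m d ↔ m' d))
    (hb : ∀ d ∈ T.D, ∀ e ∈ T.D, (b d e ↔ b' d e)) {ω : Form GuessAtom} (hω : ω ∈ c.tests T) :
    Passes m b ω ↔ Passes m' b' ω := by
  refine exists_congr fun x => ?_
  simp only [tests, List.mem_cons, List.mem_map, List.mem_append] at hω
  rcases hω with rfl | rfl | ⟨ω, hω, rfl⟩
  · simp +contextual only [DefaultTheory.holds_goodTest, hm, hb]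
  · rw [DefaultTheory.holds_badTest, DefaultTheory.holds_badTest]
    refine and_congr_right fun _ => exists_congr fun e => and_congr_right fun he => ?_
    rw [hm e he]
    refine and_congr_right fun _ => and_congr_right fun _ => forall₂_congr fun d hd => ?_
    rw [hm d hd, hb d hd e he]
  · have hover : TestOver T ω := hω.elim (hc.over₁ ω) (hc.over₂ ω)
    rw [ofTest, Form.holds_map, Form.holds_map]
    refine Form.holds_congr fun a ha => ?_
    rcases a with n | d
    · exact Iff.rfl
    · exact hm d (hover.2 d ha)

open Classical in
/-- For every guess there is a model of the translation that signals
the results of the tests. -/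
theorem Valid.exists_model (hc : c.Valid S T L₁ L₂) (m : Default → Prop)
    (b : Default → Default → Prop) : ∃ w, (c.form T).Holds w ∧ c.Signals T w ∧
      (∀ d, w (.mem d) = m d) ∧ ∀ d e, w (.bef d e) = b d e := by
  let s : ℕ → Prop := fun i => ∃ ω, (c.tests T)[i]? = some ω ∧ Passes m b ω
  have hs : ∀ i ω, (c.tests T)[i]? = some ω → (s i ↔ Passes m b ω) := by
    intro i ω h
    simp [s, h]
  -- The circuits constrain only their gates: whatever the signals are, suitable gate values exist.
  obtain ⟨g₁, hg₁⟩ := (hc.circuit₁ fun i => decide (s (i + 2))).1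
  obtain ⟨g₂, hg₂⟩ := (hc.circuit₂ fun i => decide (s (i + c.t₁.length + 2))).1
  simp only [decide_eq_true_eq] at hg₁ hg₂
  have hx : ∀ i, ∃ x, ∀ ω, (c.tests T)[i]? = some ω → s i → ω.Holds (guessVal m b x) := by
    intro i
    by_cases hi : s i
    · obtain ⟨ω, hω, x, hx⟩ := hi
      refine ⟨x, fun ω' hω' _ => ?_⟩
      rw [hω] at hω'
      cases hω'
      exact hx
    · exact ⟨fun _ => False, fun _ _ h => absurd h hi⟩
  choose x hx using hx
  let ok : Prop := g₁ c.out₁ ∧ g₂ c.out₂ ∧ s 0 ∧ ¬ s 1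
  have hy : ∃ y : ℕ → Prop, (∀ φ ∈ T.W, φ.Holds y) ∧ (ok → ∀ d ∈ T.D, m d → d.cons.Holds y) ∧
      (¬ ok → ∀ d ∈ c.fallback, d.cons.Holds y) := by
    -- An accepted guess has passed `goodTest`, whose witness satisfies the released formulae;
    -- otherwise the fallback process is consistent.
    by_cases hok : ok
    · obtain ⟨y, hy⟩ := (hs 0 T.goodTest rfl).1 hok.2.2.1
      have := DefaultTheory.holds_goodTest.1 hy
      exact ⟨y, this.1, fun _ => this.2.1, fun h => absurd hok h⟩
    · obtain ⟨y, hy⟩ := hc.isProc_fallback.consistent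
      have := DefaultTheory.models_base.1 hy
      exact ⟨y, this.1, fun h => absurd h hok, fun _ => this.2⟩
  obtain ⟨y, hy⟩ := hy
  let w : TrAtom Γ₁ Γ₂ → Prop
    | .var n => y n
    | .copy i n => x i n
    | .mem d => m d
    | .bef d e => b d e
    | .sig i => s i
    | .gate₁ g => g₁ g
    | .gate₂ g => g₂ g
    | .ok => ok
  exact ⟨w, ⟨holds_testsForm.2 fun i => hx i, holds_acceptForm.2 ⟨hg₁, hg₂, Iff.rfl⟩,
    holds_releaseForm.2 hy⟩, hs, fun _ => rfl, fun _ _ => rfl⟩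

theorem mem_guessed_mem {d : Default} (hd : d ∈ T.D) :
    (TrAtom.mem d : TrAtom Γ₁ Γ₂) ∈ guessed T := by
  simp [guessed, hd]

theorem mem_guessed_bef {d e : Default} (hd : d ∈ T.D) (he : e ∈ T.D) :
    (TrAtom.bef d e : TrAtom Γ₁ Γ₂) ∈ guessed T := by
  simp [guessed, hd, he]

/-- A model never signals a failing test. By `exists_model` some model with the same guess signals
every passing test, so maximality means that all of these are signalled; unsatisfiability thereby
becomes visible. -/
theorem Valid.isMaxModel_iff (hc : c.Valid S T L₁ L₂) :
    IsMaxModel (c.form T) (guessed T) (c.signals T) w ↔ (c.form T).Holds w ∧ c.Signals T w := by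
  have sound : ∀ {w : TrAtom Γ₁ Γ₂ → Prop}, (c.form T).Holds w → ∀ (i : ℕ) (ω : Form GuessAtom),
      (c.tests T)[i]? = some ω → w (.sig i) →
      Passes (fun d => w (.mem d)) (fun d e => w (.bef d e)) ω :=
    fun hw i ω hω hi => ⟨_, holds_testsForm.1 hw.1 i ω hω hi⟩
  constructor
  · rintro ⟨h, hmax⟩
    refine ⟨h, fun i ω hω => ⟨sound h i ω hω, fun hp => ?_⟩⟩
    obtain ⟨w', hw', hs, hm, hb⟩ := hc.exists_model (fun d => w (.mem d)) fun d e => w (.bef d e)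
    refine hmax w' hw' (fun a ha => ?_) (.sig i) ?_
      ((hs i ω hω).2 (by simpa only [hm, hb] using hp))
    · simp only [guessed, Finset.mem_union, Finset.mem_image] at ha
      rcases ha with ⟨d, -, rfl⟩ | ⟨p, -, rfl⟩
      · rw [hm]
      · rw [hb]
    · obtain ⟨hi, -⟩ := List.getElem?_eq_some_iff.1 hω
      simp [signals, hi]
  · rintro ⟨h, hs⟩
    refine ⟨h, fun w' hw' hG a ha ha' => ?_⟩
    simp only [signals, Finset.mem_image, Finset.mem_range] at ha
    obtain ⟨i, hi, rfl⟩ := ha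
    have hω := List.getElem?_eq_getElem hi
    refine (hs i _ hω).2 ((hc.passes_congr (fun d hd => hG _ (mem_guessed_mem hd))
      (fun d hd e he => hG _ (mem_guessed_bef hd he)) (List.getElem_mem hi)).1 (sound hw' i _ hω ha'))

-- The offset `k` locates the block of `t` among all tests, so that its signals form the very bit
-- string read by the function for that condition.
open Classical in
theorem signalled_results (hs : c.Signals T w) {P : List Default}
    (hP : ∀ d ∈ T.D, (w (.mem d) ↔ d ∈ P)) {t : List TestForm} (ht : ∀ ω ∈ t, TestOver T ω) {k : ℕ}
    (hk : ∀ i ω, t[i]? = some ω → (c.tests T)[i + k]? = some (ofTest ω)) :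
    ((List.range t.length).map fun i => decide (w (.sig (i + k)))) = testResults P t := by
  refine List.ext_getElem (by simp [testResults]) fun i hi _ => ?_
  have hi' : i < t.length := by simpa using hi
  simp only [testResults, List.getElem_map, List.getElem_range, decide_eq_decide]
  rw [hs _ _ (hk i _ (List.getElem?_eq_getElem hi')),
    DefaultTheory.testPasses_iff_passes hP (ht _ (List.getElem_mem hi'))]

/-- A guess is accepted exactly if it passes the tests for a process and the combined results
of the other tests are positive. -/
theorem Valid.ok_iff (hc : c.Valid S T L₁ L₂) (hw : (c.form T).Holds w) (hs : c.Signals T w)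
    {P : List Default} (hP : ∀ d ∈ T.D, (w (.mem d) ↔ d ∈ P)) :
    w .ok ↔ L₁ (testResults P c.t₁) = true ∧ L₂ (testResults P c.t₂) = true ∧
      Passes (fun d => w (.mem d)) (fun d e => w (.bef d e)) T.goodTest ∧
      ¬ Passes (fun d => w (.mem d)) (fun d e => w (.bef d e)) T.badTest := by
  classical
  obtain ⟨h₁, h₂, hok⟩ := holds_acceptForm.1 hw.2.1
  have h₁' := (hc.circuit₁ fun i => decide (w (.sig (i + 2)))).2 (fun g => w (.gate₁ g))
    (by simpa only [decide_eq_true_eq] using h₁)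
  have h₂' := (hc.circuit₂ fun i => decide (w (.sig (i + c.t₁.length + 2)))).2
    (fun g => w (.gate₂ g)) (by simpa only [decide_eq_true_eq] using h₂)
  rw [signalled_results hs hP hc.over₁ fun i ω h => ?_] at h₁'
  · simp only [add_assoc] at h₂'
    rw [signalled_results hs hP hc.over₂ fun i ω h => ?_] at h₂'
    · rw [hok, h₁', h₂', hs 0 _ rfl, hs 1 _ rfl]
    · simp [tests, ← add_assoc, List.getElem?_append_right, h]
  · obtain ⟨hi, rfl⟩ := List.getElem?_eq_some_iff.1 h
    simp [tests, List.getElem?_append_left, hi]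

/-- An accepted guess describes a successful and closed process. -/
theorem Valid.exists_isProc (hc : c.Valid S T L₁ L₂) (hw : (c.form T).Holds w)
    (hs : c.Signals T w) (hok : w .ok) :
    ∃ P, T.IsProc P ∧ S.Successful T P ∧ S.Closed T P ∧ ∀ d, d ∈ P ↔ d ∈ T.D ∧ w (.mem d) := by
  have hok' := (holds_acceptForm.1 hw.2.1).2.2.1 hok
  obtain ⟨P, hP, hmem⟩ := DefaultTheory.exists_isProc_of_tests ((hs 0 _ rfl).1 hok'.2.2.1)
    ((not_congr (hs 1 _ rfl)).1 hok'.2.2.2)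
  have h := (hc.ok_iff (P := P) hw hs fun d hd => by simp [hmem, hd]).1 hok
  exact ⟨P, hP, (hc.successful P hP).2 h.1, (hc.closed P hP).2 h.2.1, hmem⟩

/-- The valuations released by an accepted guess are the models of the process. -/
theorem released_iff_of_ok (hok : w .ok) {P : List Default}
    (hP : ∀ d, d ∈ P ↔ d ∈ T.D ∧ w (.mem d)) {x : ℕ → Prop} :
    c.Released T w x ↔ ∀ φ ∈ T.base P, φ.Holds x := by
  simp [Released, DefaultTheory.models_base, hok, hP]

theorem released_iff_of_not_ok (hok : ¬ w .ok) {x : ℕ → Prop} :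
    c.Released T w x ↔ ∀ φ ∈ T.base c.fallback, φ.Holds x := by
  simp [Released, DefaultTheory.models_base, hok]

/-! ### Faithfulness after coding the atoms by numbers -/

section Coding

variable {code : TrAtom Γ₁ Γ₂ → ℕ} {F : Set (TrAtom Γ₁ Γ₂)}

open Classical in
/-- The consequences of the translation for a maximal model, over the variables of the theory,
are the formulae true in all released valuations. -/
theorem Valid.consequences_iff (hc : c.Valid S T L₁ L₂) (hF : Set.InjOn code F)
    (hvar : ∀ n, code (.var n) = n) (hformF : (c.form T).atoms ⊆ F)
    (hG : ∀ a ∈ guessed T, a ∈ F) (hS : ∀ a ∈ c.signals T, a ∈ F)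
    (hvarF : ∀ n ∈ T.vars, .var n ∈ F) {v : ℕ → Prop}
    (hv : IsMaxModel ((c.form T).map code) ((guessed T).image code) ((c.signals T).image code) v)
    {φ : PForm} (hφ : φ.atoms ⊆ T.vars) :
    (∀ v', ((c.form T).map code).Holds v' →
      (∀ a ∈ (guessed T).image code ∪ (c.signals T).image code, (v' a ↔ v a)) → φ.Holds v') ↔
    ∀ x, c.Released T (fun a => v (code a)) x → φ.Holds x := by
  obtain ⟨hw, hs⟩ := hc.isMaxModel_iff.1 ((isMaxModel_map hF hformF hG hS).1 hv)
  simp only [← Finset.image_union, Finset.forall_mem_image, Form.holds_map]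
  constructor
  · intro h x hx
    -- The original variables occur only in `releaseForm`, so they can be changed to any released
    -- valuation while all other atoms keep their values.
    let w' : TrAtom Γ₁ Γ₂ → Prop
      | .var n => x n
      | a => v (code a)
    obtain ⟨v', hv'⟩ := exists_valuation_of_injOn hF w'
    refine (Form.holds_congr fun n hn => ?_).1 (h v' ?_ fun a ha => ?_)
    · have := hv' _ (hvarF n (hφ hn))
      rwa [hvar] at this
    · refine (Form.holds_congr fun a ha => hv' a (hformF ha)).2 ?_
      have h₁ := holds_testsForm.1 hw.1
      have h₂ := holds_acceptForm.1 hw.2.1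
      exact ⟨holds_testsForm.2 h₁, holds_acceptForm.2 h₂, holds_releaseForm.2 hx⟩
    · rw [hv' a ((Finset.mem_union.1 ha).elim (hG a) (hS a))]
      have : ∀ n, a ≠ .var n := by
        rintro n rfl
        simp [guessed, signals] at ha
      cases a with
      | var n => exact absurd rfl (this n)
      | _ => exact Iff.rfl
  · intro h v' hv' hagree
    have hsig : ∀ i ω, (c.tests T)[i]? = some ω → (v' (code (.sig i)) ↔ v (code (.sig i))) := by
      intro i ω hω
      obtain ⟨hi, -⟩ := List.getElem?_eq_some_iff.1 hω
      exact hagree (Finset.mem_union_right _ (by simp [signals, hi]))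
    have hmem : ∀ d ∈ T.D, (v' (code (.mem d)) ↔ v (code (.mem d))) := fun d hd =>
      hagree (Finset.mem_union_left _ (mem_guessed_mem hd))
    have hbef : ∀ d ∈ T.D, ∀ e ∈ T.D, (v' (code (.bef d e)) ↔ v (code (.bef d e))) :=
      fun d hd e he => hagree (Finset.mem_union_left _ (mem_guessed_bef hd he))
    have hs' : c.Signals T fun a => v' (code a) := fun i ω hω =>
      (hsig i ω hω).trans ((hs i ω hω).trans
        (hc.passes_congr hmem hbef (List.mem_of_getElem? hω)).symm)
    -- This list need not be a process: `ok_iff` uses it only as a set of defaults.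
    let P := (T.D.filter fun d => v (code (.mem d))).toList
    have hP : ∀ d ∈ T.D, (v (code (.mem d)) ↔ d ∈ P) := by simp +contextual [P]
    -- Gates and `ok` are not among the fixed atoms, but the value of `ok` is forced by the guess
    -- and the signals.
    have hok : v' (code .ok) ↔ v (code .ok) := by
      rw [hc.ok_iff hw hs hP, hc.ok_iff (w := fun a => v' (code a)) hv' hs'
        fun d hd => (hmem d hd).trans (hP d hd), hc.passes_congr hmem hbef (by simp [tests]),
        hc.passes_congr hmem hbef (by simp [tests])]
    have hrel := holds_releaseForm.1 hv'.2.2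
    simp only [hvar] at hrel
    exact h v' ⟨hrel.1, fun ho d hd hdm => hrel.2.1 (hok.2 ho) d hd ((hmem d hd).2 hdm),
      fun ho => hrel.2.2 (not_congr hok |>.2 ho)⟩

open Classical in
/-- The translation is faithful. -/
theorem Valid.faithful (hc : c.Valid S T L₁ L₂) (hF : Set.InjOn code F)
    (hvar : ∀ n, code (.var n) = n) (hformF : (c.form T).atoms ⊆ F)
    (hG : ∀ a ∈ guessed T, a ∈ F) (hS : ∀ a ∈ c.signals T, a ∈ F)
    (hvarF : ∀ n ∈ T.vars, .var n ∈ F) (h : ∃ v, ((c.form T).map code).Holds v) :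
    Faithful S reiter T (guessTheory ((c.form T).map code) ((guessed T).image code)
      ((c.signals T).image code) h) := by
  -- Every guess is realised by a maximal model, including guesses that will be rejected.
  have lift : ∀ (m : Default → Prop) (b : Default → Default → Prop), ∃ v,
      IsMaxModel ((c.form T).map code) ((guessed T).image code) ((c.signals T).image code) v ∧
      (∀ d ∈ T.D, (v (code (.mem d)) ↔ m d)) ∧
      ∀ d ∈ T.D, ∀ e ∈ T.D, (v (code (.bef d e)) ↔ b d e) := by
    intro m b
    obtain ⟨w, hw, hs, hm, hb⟩ := hc.exists_model m b
    obtain ⟨v, hv⟩ := exists_valuation_of_injOn hF w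
    have hvm : ∀ d ∈ T.D, (v (code (.mem d)) ↔ w (.mem d)) := fun d hd =>
      hv _ (hG _ (mem_guessed_mem hd))
    have hvb : ∀ d ∈ T.D, ∀ e ∈ T.D, (v (code (.bef d e)) ↔ w (.bef d e)) := fun d hd e he =>
      hv _ (hG _ (mem_guessed_bef hd he))
    refine ⟨v, (isMaxModel_map hF hformF hG hS).2 (hc.isMaxModel_iff.2
      ⟨(Form.holds_congr fun a ha => hv a (hformF ha)).2 hw, fun i ω hω => ?_⟩),
      fun d hd => by rw [hvm d hd, hm], fun d hd e he => by rw [hvb d hd e he, hb]⟩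
    obtain ⟨hi, -⟩ := List.getElem?_eq_some_iff.1 hω
    exact (hv (.sig i) (hS _ (by simp [signals, hi]))).trans ((hs i ω hω).trans
      (hc.passes_congr hvm hvb (List.mem_of_getElem? hω)).symm)
  have hext := extensions_guessTheory (Ω := (c.form T).map code) (G := (guessed T).image code)
    (S := (c.signals T).image code) (h := h) fun v₀ _ => by
      obtain ⟨v, hv, hm, hb⟩ := lift (fun d => v₀ (code (.mem d))) fun d e => v₀ (code (.bef d e))
      refine ⟨v, hv, Finset.forall_mem_image.2 fun a ha => ?_⟩
      simp only [guessed, Finset.mem_union, Finset.mem_image, Finset.mem_product] at ha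
      rcases ha with ⟨d, hd, rfl⟩ | ⟨p, hp, rfl⟩
      · exact hm d hd
      · exact hb p.1 hp.1 p.2 hp.2
  have equiv : ∀ v, IsMaxModel ((c.form T).map code) ((guessed T).image code)
      ((c.signals T).image code) v → ∀ Q : List Default,
      (∀ x, c.Released T (fun a => v (code a)) x ↔ ∀ φ ∈ T.base Q, φ.Holds x) →
      VarEquiv T.vars (Cn (T.base Q)) {φ | ∀ w, ((c.form T).map code).Holds w →
        (∀ a ∈ (guessed T).image code ∪ (c.signals T).image code, (w a ↔ v a)) → φ.Holds w} := by
    intro v hv Q hQ φ hφ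
    have hE : ∀ A B : (ℕ → Prop) → Prop, Entails {φ | ∀ w, A w → B w → φ.Holds w} φ ↔
        ∀ w, A w → B w → φ.Holds w :=
      fun A B => ⟨fun h w hA hB => h w fun ψ hψ => hψ w hA hB, fun h w hw => hw φ h⟩
    rw [entails_Cn, hE, hc.consequences_iff hF hvar hformF hG hS hvarF hv hφ]
    exact forall_congr' fun x => by rw [hQ x]
  have model : ∀ v, IsMaxModel ((c.form T).map code) ((guessed T).image code)
      ((c.signals T).image code) v → (c.form T).Holds (fun a => v (code a)) ∧
      c.Signals T fun a => v (code a) := fun v hv =>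
    hc.isMaxModel_iff.1 ((isMaxModel_map hF hformF hG hS).1 hv)
  refine faithful_of_varEquiv ?_ ?_
  · rintro _ ⟨P, hP, hsucc, hclosed, rfl⟩
    obtain ⟨b, hgood, hbad⟩ := hP.exists_passes
    obtain ⟨v, hv, hm, hb⟩ := lift (· ∈ P) b
    obtain ⟨hw, hs⟩ := model v hv
    have hok : v (code .ok) := by
      rw [hc.ok_iff hw hs hm, hc.passes_congr hm hb (by simp [tests]),
        hc.passes_congr hm hb (by simp [tests])]
      exact ⟨(hc.successful P hP).1 hsucc, (hc.closed P hP).1 hclosed, hgood, hbad⟩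
    refine ⟨_, hext ▸ ⟨v, hv, rfl⟩, equiv v hv P fun x => released_iff_of_ok hok fun d => ?_⟩
    exact ⟨fun hd => ⟨hP.mem d hd, (hm d (hP.mem d hd)).2 hd⟩, fun hd => (hm d hd.1).1 hd.2⟩
  · intro E' hE'
    rw [hext] at hE'
    obtain ⟨v, hv, rfl⟩ := hE'
    obtain ⟨hw, hs⟩ := model v hv
    by_cases hok : v (code .ok)
    · obtain ⟨P, hP, hsucc, hclosed, hmem⟩ := hc.exists_isProc hw hs hok
      exact ⟨_, ⟨P, hP, hsucc, hclosed, rfl⟩, equiv v hv P fun x => released_iff_of_ok hok hmem⟩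
    -- A rejected guess reproduces the extension of the fallback process.
    · exact ⟨_, ⟨c.fallback, hc.isProc_fallback, hc.successful_fallback, hc.closed_fallback, rfl⟩,
        equiv v hv _ fun x => released_iff_of_not_ok hok⟩

end Coding

end TrData

/-! ### The size of the translation -/

theorem eval_mono (q : Polynomial ℕ) {m n : ℕ} (h : m ≤ n) : q.eval m ≤ q.eval n := by
  rw [Polynomial.eval_eq_sum, Polynomial.eval_eq_sum]
  exact Finset.sum_le_sum fun i _ => Nat.mul_le_mul_left _ (Nat.pow_le_pow_left h i)

theorem one_le_varCost (n : ℕ) : 1 ≤ varCost n := Nat.le_add_right _ _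

theorem Form.len_le_size (φ : PForm) : φ.len ≤ φ.size := φ.len_le_sizeWith one_le_varCost

theorem Form.lt_two_pow_size {φ : PForm} {n : ℕ} (hn : n ∈ φ.atoms) : n < 2 ^ φ.size := by
  have h : varCost n ≤ φ.size := Form.le_sizeWith_of_mem_atoms hn
  exact Nat.size_le.1 (by unfold varCost at h; omega)

namespace DefaultTheory

variable {T : DefaultTheory}

theorem size_le_of_mem_W {φ : PForm} (hφ : φ ∈ T.W) : φ.size ≤ T.size :=
  (Finset.single_le_sum (fun _ _ => Nat.zero_le _) hφ).trans (Nat.le_add_right _ _)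

theorem size_le_of_mem_D {d : Default} (hd : d ∈ T.D) : d.size ≤ T.size :=
  (Finset.single_le_sum (f := Default.size) (fun _ _ => Nat.zero_le _) hd).trans
    (Nat.le_add_left _ _)

theorem card_W_le : T.W.card ≤ T.size := by
  rw [Finset.card_eq_sum_ones]
  exact (Finset.sum_le_sum fun φ _ => φ.len_pos.trans φ.len_le_size).trans (Nat.le_add_right _ _)

theorem card_D_le : T.D.card ≤ T.size := by
  rw [Finset.card_eq_sum_ones]
  refine (Finset.sum_le_sum fun d _ => ?_).trans (Nat.le_add_left _ _)
  exact (d.prec.len_pos.trans d.prec.len_le_size).trans (by unfold Default.size; omega)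

/-- Indices are written in binary. Hence the codes of the new atoms can start at `2 ^ T.size`, clear
of all variables of `T`, and still be short. -/
theorem lt_of_mem_vars {n : ℕ} (hn : n ∈ T.vars) : n < 2 ^ T.size := by
  rcases hn with ⟨φ, hφ, hn⟩ | ⟨d, hd, hn⟩
  · exact (Form.lt_two_pow_size hn).trans_le
      (Nat.pow_le_pow_right two_pos (size_le_of_mem_W hφ))
  · have h := size_le_of_mem_D hd
    unfold Default.size at h
    rcases hn with (hn | hn) | hn <;>
      exact (Form.lt_two_pow_size hn).trans_le (Nat.pow_le_pow_right two_pos (by omega))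

theorem len_cons_le {d : Default} (hd : d ∈ T.D) : d.cons.len ≤ T.size := by
  have h := size_le_of_mem_D hd
  have := d.cons.len_le_size
  unfold Default.size at h
  omega

theorem len_prec_le {d : Default} (hd : d ∈ T.D) : d.prec.len ≤ T.size := by
  have h := size_le_of_mem_D hd
  have := d.prec.len_le_size
  unfold Default.size at h
  omega

theorem len_background_le : T.background.len ≤ T.size * (T.size + 1) + 2 := by
  refine (Form.len_conjList_le (m := T.size) fun φ hφ => ?_).trans ?_
  · exact φ.len_le_size.trans (size_le_of_mem_W (Finset.mem_toList.1 hφ))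
  · have := T.card_W_le
    rw [Finset.length_toList]
    gcongr

theorem len_conjList_D_le {α : Type} {f : Default → Form α} {m : ℕ}
    (h : ∀ d ∈ T.D, (f d).len ≤ m) :
    (Form.conjList (T.D.toList.map f)).len ≤ T.size * (m + 1) + 2 := by
  refine (Form.len_conjList_le (m := m) ?_).trans ?_
  · simpa using h
  · have := T.card_D_le
    rw [List.length_map, Finset.length_toList]
    gcongr

end DefaultTheory

/-! ### Explicit polynomial bounds -/

section Bounds

variable {R : Type} [CommSemiring R]

/-- A bound on the length of the tests of a translation. -/
def testBound (s a b : R) : R :=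
  -- The constant 11 pays for the four final `verum`s and three conjunctions of `goodTest`; the
  -- second line is for `badTest`, and `a`, `b` for the given tests.
  s * (s + 1) + s * (s + 2 + 1) + s * (2 + 1) + s * (s * s) * 6 + 11 +
    (s * (s + 1) + s * (s + (s * (s + 4 + 1) + 6) + 1) + 6) + a + b

/-- A bound on the length of the background theory of a translation. -/
def formBound (s a b e f : R) : R :=
  (a + b + 2) * (testBound s a b + 3) + e + f + s * (s + 1) + s * (s + 2 + 1) + s * (s + 1) + 50

/-- A bound on the cost of an atom of a translation. -/
def atomBound (s a b e f : R) : R :=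
  s + (formBound s a b e f + (s + s * s) + (a + b + 2)) + 2

/-- A bound on the size of a translation. -/
def translationBound (s a b e f : R) : R :=
  formBound s a b e f * atomBound s a b e f +
    (2 * (s + s * s) + (a + b + 2)) * (2 * atomBound s a b e f + 4)

/-- The bounds are semiring expressions, so one definition serves both as a polynomial and as its
numerical value. -/
theorem eval_translationBound (s a b e f : Polynomial ℕ) (n : ℕ) :
    (translationBound s a b e f).eval n =
      translationBound (s.eval n) (a.eval n) (b.eval n) (e.eval n) (f.eval n) := by
  simp [translationBound, atomBound, formBound, testBound]

end Bounds

theorem DefaultTheory.len_goodTest_add_len_badTest_le {T : DefaultTheory} :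
    T.goodTest.len + T.badTest.len ≤ testBound T.size 0 0 := by
  have hbg := T.len_background_le
  have hcard := T.card_D_le
  have h1 : (Form.conjList (T.D.toList.map fun d =>
      Form.imp (memAtom d) (d.cons.map .inl))).len ≤ T.size * (T.size + 2 + 1) + 2 := by
    refine T.len_conjList_D_le fun d hd => ?_
    have := T.len_cons_le hd
    simp only [Form.len_imp, Form.len_atom, Form.len_map]
    omega
  have h2 : (Form.conjList (T.D.toList.map fun d => Form.neg (befAtom d d))).len ≤
      T.size * (2 + 1) + 2 := T.len_conjList_D_le fun d _ => by simp
  have h3 : (Form.conjList ((T.D.toList ×ˢ (T.D.toList ×ˢ T.D.toList)).map fun p =>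
      Form.imp (.conj (befAtom p.1 p.2.1) (befAtom p.2.1 p.2.2)) (befAtom p.1 p.2.2))).len ≤
      T.size * (T.size * T.size) * 6 + 2 := by
    refine (Form.len_conjList_le (m := 5) ?_).trans ?_
    · simp only [List.forall_mem_map]
      exact fun _ _ => le_rfl
    simp only [List.length_map, List.length_product, Finset.length_toList]
    gcongr
  have h4 : (Form.disjList (T.D.toList.map fun e => Form.conj (memAtom e) <|
      .conj (.neg (e.prec.map .inl)) <| .conjList (T.D.toList.map fun d =>
        .imp (.conj (memAtom d) (befAtom d e)) (d.cons.map .inl)))).len ≤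
      T.size * (T.size + (T.size * (T.size + 4 + 1) + 6) + 1) + 2 := by
    refine (Form.len_disjList_le (m := T.size + (T.size * (T.size + 4 + 1) + 6)) ?_).trans ?_
    · simp only [List.forall_mem_map, Finset.mem_toList]
      intro e he
      have := T.len_prec_le he
      have h : (Form.conjList (T.D.toList.map fun d =>
          Form.imp (.conj (memAtom d) (befAtom d e)) (d.cons.map .inl))).len ≤
          T.size * (T.size + 4 + 1) + 2 := by
        refine T.len_conjList_D_le fun d hd => ?_
        have := T.len_cons_le hd
        simp only [Form.len_imp, Form.len_conj, Form.len_atom, Form.len_map]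
        omega
      simp only [Form.len_conj, Form.len_neg, Form.len_atom, Form.len_map]
      omega
    · rw [List.length_map, Finset.length_toList]
      gcongr
  simp only [goodTest, badTest, testBound, Form.len_conj, Form.len_map]
  omega

namespace TrData

variable {Γ₁ Γ₂ : Type} {c : TrData Γ₁ Γ₂} {T : DefaultTheory} {S : Semantics}
  {L₁ L₂ : List Bool → Bool} {a b e f : ℕ}

theorem length_tests : (c.tests T).length = c.t₁.length + c.t₂.length + 2 := by
  simp [tests]

theorem len_form_le (hfD : ∀ d ∈ c.fallback, d ∈ T.D) (hfn : c.fallback.Nodup)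
    (h₁ : c.t₁.length ≤ a) (h₂ : c.t₂.length ≤ b) (h₁' : ∀ ω ∈ c.t₁, testSize ω ≤ a)
    (h₂' : ∀ ω ∈ c.t₂, testSize ω ≤ b) (he : c.φ₁.len ≤ e) (hf : c.φ₂.len ≤ f) :
    (c.form T).len ≤ formBound T.size a b e f := by
  have hgb := T.len_goodTest_add_len_badTest_le
  have hbg := T.len_background_le
  have hM : testBound T.size a b = testBound T.size 0 0 + a + b := by simp [testBound]
  have hlen : ∀ ω : TestForm, (ofTest ω).len ≤ testSize ω := fun ω => by
    rw [ofTest, Form.len_map]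
    refine Form.len_le_sizeWith (fun x => ?_) ω
    rcases x with n | d
    exacts [one_le_varCost n, le_rfl]
  have htests : ∀ ω ∈ c.tests T, ω.len ≤ testBound T.size a b := by
    simp only [tests, List.mem_cons, List.mem_map, List.mem_append]
    rintro _ (rfl | rfl | ⟨ω, hω | hω, rfl⟩)
    · omega
    · omega
    · have := hlen ω
      have := h₁' ω hω
      omega
    · have := hlen ω
      have := h₂' ω hω
      omega
  have k1 : (c.testsForm T).len ≤ (a + b + 2) * (testBound T.size a b + 3) + 2 := by
    refine (Form.len_conjList_le (m := testBound T.size a b + 2) ?_).trans ?_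
    · simp only [List.forall_mem_map, Prod.forall, List.mem_zipIdx_iff_getElem?]
      intro ω i hω
      have := htests ω (List.mem_of_getElem? hω)
      simp only [Form.len_imp, Form.len_atom, Form.len_map]
      omega
    · rw [List.length_map, List.length_zipIdx, length_tests]
      gcongr
  have k2 : c.acceptForm.len ≤ e + f + 23 := by
    simp only [acceptForm, Form.len_conj, Form.len_map, Form.len_iff, Form.len_atom, Form.len_neg]
    omega
  have k3 : (Form.conjList (T.D.toList.map fun d => Form.imp (.atom (.mem d : TrAtom Γ₁ Γ₂))
      (d.cons.map .var))).len ≤ T.size * (T.size + 2 + 1) + 2 := by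
    refine T.len_conjList_D_le fun d hd => ?_
    have := T.len_cons_le hd
    simp only [Form.len_imp, Form.len_atom, Form.len_map]
    omega
  have k4 : (Form.conjList (c.fallback.map fun d => d.cons.map (.var : ℕ → TrAtom Γ₁ Γ₂))).len ≤
      T.size * (T.size + 1) + 2 := by
    refine (Form.len_conjList_le (m := T.size) ?_).trans ?_
    · simp only [List.forall_mem_map, Form.len_map]
      exact fun d hd => T.len_cons_le (hfD d hd)
    · have : c.fallback.length ≤ T.size := by
        classical
        rw [← List.toFinset_card_of_nodup hfn]
        exact (Finset.card_le_card fun d hd => hfD d (List.mem_toFinset.1 hd)).trans T.card_D_le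
      rw [List.length_map]
      gcongr
  simp only [form, releaseForm, formBound, Form.len_conj, Form.len_imp, Form.len_neg, Form.len_atom,
    Form.len_map]
  omega

/-- Guarantees that the variables kept under their own index lie below `2 ^ T.size`, outside the
range of the new codes. -/
theorem mem_vars_of_mem_atoms_form (hfD : ∀ d ∈ c.fallback, d ∈ T.D) {n : ℕ}
    (hn : .var n ∈ (c.form T).atoms) : n ∈ T.vars := by
  have htest : ∀ i x, testAtom i x ≠ (.var n : TrAtom Γ₁ Γ₂) := by
    rintro i (x | x | x) <;> simp [testAtom]
  have hacc₁ : ∀ x : ℕ ⊕ Γ₁, Sum.elim (fun i => TrAtom.sig (i + 2)) .gate₁ x ≠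
      (.var n : TrAtom Γ₁ Γ₂) := by
    rintro (x | x) <;> simp
  have hacc₂ : ∀ x : ℕ ⊕ Γ₂, Sum.elim (fun i => TrAtom.sig (i + c.t₁.length + 2)) .gate₂ x ≠
      (.var n : TrAtom Γ₁ Γ₂) := by
    rintro (x | x) <;> simp
  simp only [form, testsForm, acceptForm, releaseForm, Form.atoms, Form.iff, Form.atoms_conjList,
    Form.atoms_map, DefaultTheory.background, Set.mem_union, Set.mem_ofPred_eq, Set.mem_image,
    List.mem_map, exists_exists_and_eq_and, Set.mem_singleton_iff, htest, hacc₁, hacc₂,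
    reduceCtorEq, TrAtom.var.injEq, exists_eq_right, and_false, false_or, or_false, exists_false,
    Finset.mem_toList] at hn
  rcases hn with ⟨φ, hφ, hn⟩ | ⟨d, hd, hn⟩ | ⟨d, hd, hn⟩
  · exact Or.inl ⟨φ, hφ, hn⟩
  · exact Or.inr ⟨d, hd, Or.inr hn⟩
  · exact Or.inr ⟨d, hfD d hd, Or.inr hn⟩

theorem card_guessed_le : (guessed T : Finset (TrAtom Γ₁ Γ₂)).card ≤ T.size + T.size * T.size := by
  classical
  have := T.card_D_le
  refine (Finset.card_union_le _ _).trans (Nat.add_le_add (Finset.card_image_le.trans this)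
    (Finset.card_image_le.trans ?_))
  rw [Finset.card_product]
  gcongr

theorem card_signals_le : (c.signals T).card ≤ c.t₁.length + c.t₂.length + 2 := by
  classical
  refine Finset.card_image_le.trans ?_
  rw [Finset.card_range, length_tests]

/-- The atoms of the translation can be coded by small numbers without changing the
variables. -/
theorem exists_code (F₀ : Finset (TrAtom Γ₁ Γ₂)) (N : ℕ) :
    ∃ code : TrAtom Γ₁ Γ₂ → ℕ, (∀ n, code (.var n) = n) ∧
      Set.InjOn code {x | (∃ n < N, x = .var n) ∨ x ∈ F₀ ∧ ∀ n, x ≠ .var n} ∧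
      ∀ x ∈ F₀, (∀ n, x = .var n → n < N) → code x < N + F₀.card := by
  classical
  let code : TrAtom Γ₁ Γ₂ → ℕ
    | .var n => n
    | x => N + F₀.toList.idxOf x
  have hcode : ∀ x, (∀ n, x ≠ .var n) → code x = N + F₀.toList.idxOf x := by
    intro x hx
    cases x with
    | var n => exact absurd rfl (hx n)
    | _ => rfl
  refine ⟨code, fun _ => rfl, ?_, fun x hx hxN => ?_⟩
  · rintro x (⟨n, hn, rfl⟩ | ⟨hx, hx'⟩) y (⟨m, hm, rfl⟩ | ⟨hy, hy'⟩) h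
    · exact congrArg _ h
    · rw [hcode y hy'] at h
      change n = _ at h
      omega
    · rw [hcode x hx'] at h
      change _ = m at h
      omega
    · rw [hcode x hx', hcode y hy'] at h
      exact (List.idxOf_inj (Finset.mem_toList.2 hx)).1 (Nat.add_left_cancel h)
  · by_cases hx' : ∀ n, x ≠ .var n
    · rw [hcode x hx', ← Finset.length_toList]
      exact Nat.add_lt_add_left (List.idxOf_lt_length_of_mem (Finset.mem_toList.2 hx)) N
    · push Not at hx'
      obtain ⟨n, rfl⟩ := hx'
      exact (hxN n rfl).trans_le (Nat.le_add_right _ _)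

end TrData

theorem varCost_le_of_lt {n s k : ℕ} (h : n < 2 ^ s + k) : varCost n ≤ s + k + 2 := by
  have : n < 2 ^ (s + k + 1) := by
    have h₁ : 2 ^ s ≤ 2 ^ (s + k) := Nat.pow_le_pow_right two_pos (Nat.le_add_right s k)
    have h₂ : k < 2 ^ (s + k) := Nat.lt_two_pow_self.trans_le
      (Nat.pow_le_pow_right two_pos (Nat.le_add_left k s))
    rw [pow_succ]
    omega
  have := Nat.size_le.2 this
  unfold varCost
  omega

theorem size_guessTheory_le {Ω : PForm} {G S : Finset ℕ} {h : ∃ v, Ω.Holds v} {B : ℕ}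
    (hG : ∀ a ∈ G, varCost a ≤ B) (hS : ∀ a ∈ S, varCost a ≤ B) :
    (guessTheory Ω G S h).size ≤ Ω.size + (2 * G.card + S.card) * (2 * B + 4) := by
  classical
  have hcard : (guesses G S).card ≤ 2 * G.card + S.card := by
    have h₁ : (G.image (Form.atom : ℕ → PForm)).card ≤ G.card := Finset.card_image_le
    have h₂ : (G.image fun a => (Form.neg (.atom a) : PForm)).card ≤ G.card := Finset.card_image_le
    have h₃ : (S.image (Form.atom : ℕ → PForm)).card ≤ S.card := Finset.card_image_le
    refine (Finset.card_union_le _ _).trans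
      ((Nat.add_le_add (Finset.card_union_le _ _) le_rfl).trans ?_)
    omega
  -- The precondition `verum` costs 2; a possibly negated atom costs at most `B + 1` and occurs as
  -- justification and as consequence.
  have hsize : ∀ d ∈ (guessTheory Ω G S h).D, d.size ≤ 2 * B + 4 := by
    intro d hd
    obtain ⟨φ, hφ, rfl⟩ := mem_guessTheory_D.1 hd
    have hv : Form.size Form.verum = 2 := rfl
    rcases mem_guesses.1 hφ with ⟨a, ha, rfl⟩ | ⟨a, ha, rfl⟩ | ⟨a, ha, rfl⟩
    · have := hG a ha
      simp only [Default.size, Default.free, hv]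
      simp only [Form.size, Form.sizeWith]
      omega
    · have := hG a ha
      simp only [Default.size, Default.free, hv]
      simp only [Form.size, Form.sizeWith]
      omega
    · have := hS a ha
      simp only [Default.size, Default.free, hv]
      simp only [Form.size, Form.sizeWith]
      omega
  unfold DefaultTheory.size
  refine Nat.add_le_add (by simp [guessTheory]) ((Finset.sum_le_card_nsmul _ _ _ hsize).trans ?_)
  rw [smul_eq_mul]
  exact Nat.mul_le_mul_right _ (Finset.card_image_le.trans hcard)

/-- Every theory for which there are valid data has a faithful translation of bounded size. -/
theorem TrData.Valid.exists_translation {Γ₁ Γ₂ : Type} {c : TrData Γ₁ Γ₂} {T : DefaultTheory}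
    {S : Semantics} {L₁ L₂ : List Bool → Bool} (hc : c.Valid S T L₁ L₂) {a b e f : ℕ}
    (h₁ : c.t₁.length ≤ a) (h₂ : c.t₂.length ≤ b) (h₁' : ∀ ω ∈ c.t₁, testSize ω ≤ a)
    (h₂' : ∀ ω ∈ c.t₂, testSize ω ≤ b) (he : c.φ₁.len ≤ e) (hf : c.φ₂.len ≤ f) :
    ∃ T' : DefaultTheory, T'.IsNormal ∧ T'.size ≤ translationBound T.size a b e f ∧
      Faithful S reiter T T' := by
  classical
  have hlen := len_form_le hc.isProc_fallback.mem hc.isProc_fallback.nodup h₁ h₂ h₁' h₂' he hf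
  have hcardG : (guessed T : Finset (TrAtom Γ₁ Γ₂)).card ≤ _ := card_guessed_le
  have hcardS : (c.signals T).card ≤ _ := card_signals_le
  let A := (c.form T).atoms_finite.toFinset
  let F₀ := A ∪ (guessed T ∪ c.signals T)
  have hA : A.card ≤ (c.form T).len := by
    rw [← Set.ncard_eq_toFinset_card _ (c.form T).atoms_finite]
    exact (c.form T).ncard_atoms_le
  have hF₀ : F₀.card ≤ formBound T.size a b e f + (T.size + T.size * T.size) + (a + b + 2) := by
    have : F₀.card ≤ _ := Finset.card_union_le A (guessed T ∪ c.signals T)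
    have := Finset.card_union_le (guessed T) (c.signals T)
    omega
  have hvarF₀ : ∀ n, .var n ∈ F₀ → n ∈ T.vars := by
    intro n hn
    simp only [F₀, A, Finset.mem_union, Set.Finite.mem_toFinset] at hn
    rcases hn with hn | hn | hn
    · exact mem_vars_of_mem_atoms_form hc.isProc_fallback.mem hn
    · simp [guessed] at hn
    · simp [signals] at hn
  obtain ⟨code, hvar, hinj, hlt⟩ := exists_code F₀ (2 ^ T.size)
  set F : Set (TrAtom Γ₁ Γ₂) := {x | (∃ n < 2 ^ T.size, x = .var n) ∨ x ∈ F₀ ∧ ∀ n, x ≠ .var n}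
  have hF : ∀ x ∈ F₀, x ∈ F := by
    intro x hx
    by_cases hx' : ∀ n, x ≠ .var n
    · exact Or.inr ⟨hx, hx'⟩
    · push Not at hx'
      obtain ⟨n, rfl⟩ := hx'
      exact Or.inl ⟨n, T.lt_of_mem_vars (hvarF₀ n hx), rfl⟩
  have hcost : ∀ x ∈ F₀, varCost (code x) ≤ atomBound T.size a b e f := by
    intro x hx
    have := varCost_le_of_lt (hlt x hx fun n hn => T.lt_of_mem_vars (hvarF₀ n (hn ▸ hx)))
    unfold atomBound
    omega
  have hform : (c.form T).atoms ⊆ F := fun x hx => hF x (by simp [F₀, A, hx])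
  have hG : ∀ x ∈ guessed T, x ∈ F := fun x hx => hF x (by simp [F₀, hx])
  have hS : ∀ x ∈ c.signals T, x ∈ F := fun x hx => hF x (by simp [F₀, hx])
  have hvarF : ∀ n ∈ T.vars, .var n ∈ F := fun n hn => Or.inl ⟨n, T.lt_of_mem_vars hn, rfl⟩
  have hcons : ∃ v, ((c.form T).map code).Holds v := by
    obtain ⟨w, hw, -⟩ := hc.exists_model (fun _ => False) fun _ _ => False
    obtain ⟨v, hv⟩ := exists_valuation_of_injOn hinj w
    exact ⟨v, (Form.holds_map _ _ _).2 ((Form.holds_congr fun x hx => hv x (hform hx)).2 hw)⟩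
  refine ⟨_, guessTheory_isNormal, ?_, hc.faithful hinj hvar hform hG hS hvarF hcons⟩
  refine (size_guessTheory_le (B := atomBound T.size a b e f) ?_ ?_).trans ?_
  · exact Finset.forall_mem_image.2 fun x hx => hcost x (by simp [F₀, hx])
  · exact Finset.forall_mem_image.2 fun x hx => hcost x (by simp [F₀, hx])
  · have hB : 1 ≤ atomBound T.size a b e f := by
      unfold atomBound
      omega
    have hsize := Form.sizeWith_le_len_mul (w := varCost) hB (φ := (c.form T).map code) (by
      rw [Form.atoms_map]
      rintro _ ⟨x, hx, rfl⟩
      exact hcost x (by simp [F₀, A, hx]))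
    rw [Form.len_map] at hsize
    unfold translationBound
    refine Nat.add_le_add (hsize.trans (Nat.mul_le_mul_right _ hlen)) (Nat.mul_le_mul_right _ ?_)
    have := (Finset.card_image_le (s := guessed T) (f := code)).trans hcardG
    have := (Finset.card_image_le (s := c.signals T) (f := code)).trans hcardS
    omega

end DefaultLogic

/-! ### The main theorem -/

theorem mainTheorem1 (S : DefaultLogic.Semantics) (hS : S.IsRegular) :
    ∃ (tr : DefaultLogic.DefaultTheory → DefaultLogic.DefaultTheory) (p : Polynomial ℕ),
      ∀ T : DefaultLogic.DefaultTheory, (S.extensions T).Nonempty →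
        (tr T).IsNormal ∧ (tr T).size ≤ p.eval T.size ∧
        DefaultLogic.Faithful S DefaultLogic.reiter T (tr T) := by
  obtain ⟨t₁, q₁, L₁, hlen₁, hsize₁, hL₁, hC₁⟩ := hS.successful_tests
  obtain ⟨t₂, q₂, L₂, hlen₂, hsize₂, hL₂, hC₂⟩ := hS.closed_tests
  obtain ⟨Γ₁, r₁, h₁⟩ := hL₁.exists_form
  obtain ⟨Γ₂, r₂, h₂⟩ := hL₂.exists_form
  choose φ₁ out₁ hφ₁ hcirc₁ using h₁
  choose φ₂ out₂ hφ₂ hcirc₂ using h₂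
  have key : ∀ T : DefaultLogic.DefaultTheory, ∃ T' : DefaultLogic.DefaultTheory,
      (S.extensions T).Nonempty → T'.IsNormal ∧
      -- A circuit has as many inputs as there are tests, whence the compositions of `r₁`, `r₂` with
      -- `q₁`, `q₂`.
      T'.size ≤ (DefaultLogic.translationBound Polynomial.X q₁ q₂ (r₁.comp q₁) (r₂.comp q₂)).eval
        T.size ∧ DefaultLogic.Faithful S DefaultLogic.reiter T T' := by
    intro T
    by_cases hT : (S.extensions T).Nonempty
    · obtain ⟨E, P, hP, hsucc, hclosed, -⟩ := hT
      let c : DefaultLogic.TrData Γ₁ Γ₂ := ⟨t₁ T, t₂ T, φ₁ (t₁ T).length, φ₂ (t₂ T).length,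
        out₁ (t₁ T).length, out₂ (t₂ T).length, P⟩
      have hc : c.Valid S T L₁ L₂ :=
        { over₁ := fun ω hω => (hsize₁ T ω hω).1
          over₂ := fun ω hω => (hsize₂ T ω hω).1
          circuit₁ := hcirc₁ _
          circuit₂ := hcirc₂ _
          successful := hC₁ T
          closed := hC₂ T
          isProc_fallback := hP
          successful_fallback := hsucc
          closed_fallback := hclosed }
      obtain ⟨T', hnormal, hsize, hfaithful⟩ := hc.exists_translation (hlen₁ T) (hlen₂ T)
        (fun ω hω => (hsize₁ T ω hω).2) (fun ω hω => (hsize₂ T ω hω).2)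
        ((hφ₁ _).trans (DefaultLogic.eval_mono r₁ (hlen₁ T)))
        ((hφ₂ _).trans (DefaultLogic.eval_mono r₂ (hlen₂ T)))
      refine ⟨T', fun _ => ⟨hnormal, ?_, hfaithful⟩⟩
      rw [DefaultLogic.eval_translationBound]
      simpa using hsize
    -- Nothing is claimed for a theory without extensions, so `T` is an arbitrary value.
    · exact ⟨T, fun h => absurd h hT⟩
  choose tr htr using key
  exact ⟨tr, _, htr⟩
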